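/- **Setting.** Let $(P,w)$ be a weighted set of points $p_1,\dots,p_n\in\mathbb{R}^d$ with weights $w(p_j)\ge 0$, let $p=p_i\in P$, let $k$ be an integer with $0\le k\le d-1$, and let $\varepsilon\in(0,\tfrac1{12}]$. Let $D(x,S)=\mathrm{dist}(x,S)^2$ be the squared Euclidean distance, and let $$s(p)=\sup_{S}\frac{w(p)\,D(p,S)}{\sum_{q\in P}w(q)\,D(q,S)}$$ be the sensitivity of $p$, where $S$ ranges over the affine $k$-dimensional subspaces of $\mathbb{R}^d$ for which the denominator is not zero (the supremum of the empty set being $0$). **Algorithm Non-Affine-Sensitivity$(P,w,p,k,\varepsilon)$**, for points in $\mathbb{R}^D$ and $0\le k\le D-1$. Let $\mathbf P$ be the $n\times D$ matrix with rows $\sqrt{w(p_j)}\,p_j^T$ and let $\mathbf p$ be its $i$-th row. * If $k=D-1$: take a thin singular value decomposition $\mathbf P=U\Sigma V^T$ (inner dimension $\operatorname{rank}\mathbf P$, $U^TU=V^TV=I$, $\Sigma$ diagonal) and return $\|u\|_2^2$, where $u$ is the $i$-th row of $U$. * Otherwise let $\ell=D-k$, let $\lambda_1\ge\dots\ge\lambda_D$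 be the eigenvalues of $\mathbf P^T\mathbf P$, let $\gamma=\sum_{j=1}^{\ell}\lambda_{D-j+1}\big/\sum_{j=1}^{\ell}\lambda_j$, and start with an arbitrary $D\times\ell$ matrix $X_1$ with orthonormal columns. In iteration $j=1,2,\dots$ compute $s_j=\|\mathbf pX_j\|_2^2/\|\mathbf PX_j\|_F^2$ (the run fails if the denominator is zero), put $G=\mathbf p^T\mathbf p-s_j\mathbf P^T\mathbf P$, and let the columns of $X_{j+1}$ be orthonormal eigenvectors of $G$ for its $\ell$ largest eigenvalues (arbitrarily chosen). After iteration $j$ the loop continues if and only if $j=1$ or $s_j-\frac{\varepsilon\gamma}{1-\gamma}\ge s_{j-1}$. When it stops, return $s_j+\varepsilon$. **Algorithm Affine-Sensitivity$(P,w,p,k,\varepsilon)$.** Let $\psi=(\varepsilon/2)^2$ and $r=1+\max_{q\in P}\frac{\|q\|_2^2}{\psi\varepsilon^2}$. Replace every $q\in P$ by $q'=(q\mid r)\in\mathbb{R}^{d+1}$ with the same weight, let $P'$ be the resulting weighted set, let $s'$ be the output of Non-Affine-Sensitivity$(P',w,p',k+1,\varepsilon)$, and return $\tilde s=s'+80\varepsilon$.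 **Theorem.** Every output $\tilde s$ of Affine-Sensitivity$(P,w,p,k,\varepsilon)$, whatever choices are made during the run, satisfies $$s(p)\le\tilde s\le s(p)+161\,\varepsilon .$$ Moreover, if $k=d-1$, or if $\sum_{q\in P}w(q)D(q,S)\ne0$ for every affine $k$-dimensional subspace $S$ of $\mathbb{R}^d$, then the algorithm does have an output, and every run of it terminates after finitely many iterations without failure. -/

import Mathlib

open scoped Matrix

namespace AffineSens

noncomputable section

/-! ### Query spaces and sensitivity -/

/-- The squared Euclidean distance `D(x, S)` from a point to a set. -/
def sqDist {d : ℕ} (x : EuclideanSpace ℝ (Fin d)) (S : Set (EuclideanSpace ℝ (Fin d))) : ℝ :=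
  Metric.infDist x S ^ 2

/-- The set of all affine `k`-subspaces (`k`-flats) of `ℝ^d`. -/
def affineFlats (d k : ℕ) : Set (AffineSubspace ℝ (EuclideanSpace ℝ (Fin d))) :=
  {S | (S : Set (EuclideanSpace ℝ (Fin d))).Nonempty ∧ Module.finrank ℝ S.direction = k}

/-- The weighted cost `∑_q w(q) D(q, S)` of the weighted points `(p, w)`. -/
def cost {n d : ℕ} (p : Fin n → EuclideanSpace ℝ (Fin d)) (w : Fin n → ℝ)
    (S : Set (EuclideanSpace ℝ (Fin d))) : ℝ :=
  ∑ j, w j * sqDist (p j) S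

/-- The sensitivity of the `i`-th point with respect to affine `k`-subspaces: the supremum of
`w(p) D(p, S) / ∑_q w(q) D(q, S)` over those `S` for which the denominator is not zero.
All these quotients lie in `[0, 1]` when the weights are nonnegative. -/
def affineSensitivity {n d : ℕ} (p : Fin n → EuclideanSpace ℝ (Fin d)) (w : Fin n → ℝ)
    (i : Fin n) (k : ℕ) : ℝ :=
  sSup {x : ℝ | ∃ S ∈ affineFlats d k, cost p w (S : Set _) ≠ 0 ∧
    x = w i * sqDist (p i) (S : Set _) / cost p w (S : Set _)}

/-! ### The algorithm Non-Affine-Sensitivity -/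

/-- The matrix whose `j`-th row is `√(w j)` times the `j`-th point. -/
def weightedMatrix {n D : ℕ} (p : Fin n → EuclideanSpace ℝ (Fin D)) (w : Fin n → ℝ) :
    Matrix (Fin n) (Fin D) ℝ :=
  Matrix.of fun j a => Real.sqrt (w j) * p j a

/-- `(U, σ, V)` is a thin singular value decomposition `A = U diag(σ) Vᵀ`, whose inner dimension
is the rank of `A`. -/
def IsThinSVD {n D : ℕ} (A : Matrix (Fin n) (Fin D) ℝ) (U : Matrix (Fin n) (Fin A.rank) ℝ)
    (σ : Fin A.rank → ℝ) (V : Matrix (Fin D) (Fin A.rank) ℝ) : Prop :=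
  Uᵀ * U = 1 ∧ Vᵀ * V = 1 ∧ A = U * Matrix.diagonal σ * Vᵀ

theorem isHermitian_gram {n D : ℕ} (A : Matrix (Fin n) (Fin D) ℝ) : (Aᵀ * A).IsHermitian := by
  simpa using Matrix.isHermitian_conjTranspose_mul_self A

/-- The quotient `γ` of the sum of the `ℓ` smallest by the sum of the `ℓ` largest eigenvalues of
`AᵀA`, counted with multiplicity (`eigenvalues₀` lists them in decreasing order). -/
def gammaRatio {n D : ℕ} (A : Matrix (Fin n) (Fin D) ℝ) (ℓ : ℕ) : ℝ :=
  (∑ a with D - ℓ ≤ (a : Fin (Fintype.card (Fin D))).val, (isHermitian_gram A).eigenvalues₀ a) /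
    (∑ a with (a : Fin (Fintype.card (Fin D))).val < ℓ, (isHermitian_gram A).eigenvalues₀ a)

/-- The squared Frobenius norm `‖A X‖_F²`. -/
def frobSq {n D ℓ : ℕ} (A : Matrix (Fin n) (Fin D) ℝ) (X : Matrix (Fin D) (Fin ℓ) ℝ) : ℝ :=
  ∑ j, ∑ b, (A * X) j b ^ 2

/-- The quotient `‖aX‖² / ‖A X‖_F²`, where `a` is the `i`-th row of `A`. -/
def rowRatio {n D ℓ : ℕ} (A : Matrix (Fin n) (Fin D) ℝ) (i : Fin n)
    (X : Matrix (Fin D) (Fin ℓ) ℝ) : ℝ :=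
  (∑ b, (A * X) i b ^ 2) / frobSq A X

/-- The matrix `G = aᵀa - s AᵀA`, where `a` is the `i`-th row of `A`. -/
def pencil {n D : ℕ} (A : Matrix (Fin n) (Fin D) ℝ) (i : Fin n) (s : ℝ) :
    Matrix (Fin D) (Fin D) ℝ :=
  Matrix.vecMulVec (A i) (A i) - s • (Aᵀ * A)

theorem isHermitian_pencil {n D : ℕ} (A : Matrix (Fin n) (Fin D) ℝ) (i : Fin n) (s : ℝ) :
    (pencil A i s).IsHermitian := by
  ext a b
  simp [pencil, Matrix.vecMulVec_apply, Matrix.mul_apply, mul_comm]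

/-- The columns of `X` are orthonormal eigenvectors of the symmetric matrix `G` for its `ℓ`
largest eigenvalues, counted with multiplicity. -/
def IsTopEigenvectors {D ℓ : ℕ} {G : Matrix (Fin D) (Fin D) ℝ} (hG : G.IsHermitian)
    (X : Matrix (Fin D) (Fin ℓ) ℝ) : Prop :=
  Xᵀ * X = 1 ∧
    ∀ (b : Fin ℓ) (a : Fin (Fintype.card (Fin D))), a.val = b.val →
      G *ᵥ (fun c => X c b) = hG.eigenvalues₀ a • (fun c => X c b)

/-- A state of the while loop: the current matrix `X` and the quotients computed in the last
iteration (`sNew`) and in the one before (`sOld`). Initially both are `none`; `sNew = none` stands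
for `+∞` and `sOld = none` for `-∞`. -/
structure LoopState (D ℓ : ℕ) where
  X : Matrix (Fin D) (Fin ℓ) ℝ
  sNew : Option ℝ
  sOld : Option ℝ

/-- The loop condition `sNew - c ≥ sOld`; it holds if `sNew = +∞` or `sOld = -∞`. -/
def LoopState.Continues {D ℓ : ℕ} (st : LoopState D ℓ) (c : ℝ) : Prop :=
  ∀ s t : ℝ, st.sNew = some s → st.sOld = some t → t ≤ s - c

/-- One iteration of the while loop. It can be executed only if the division in
`‖aX‖² / ‖A X‖_F²` is defined; the choice of the eigenvectors is arbitrary. -/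
inductive LoopStep {n D ℓ : ℕ} (A : Matrix (Fin n) (Fin D) ℝ) (i : Fin n) (c : ℝ) :
    LoopState D ℓ → LoopState D ℓ → Prop
  | step (st : LoopState D ℓ) (X' : Matrix (Fin D) (Fin ℓ) ℝ) (hcont : st.Continues c)
      (hdiv : frobSq A st.X ≠ 0)
      (hX' : IsTopEigenvectors (isHermitian_pencil A i (rowRatio A i st.X)) X') :
      LoopStep A i c st ⟨X', some (rowRatio A i st.X), st.sNew⟩

/-- The number `εγ/(1-γ)` in the loop condition. -/
def threshold {n D : ℕ} (A : Matrix (Fin n) (Fin D) ℝ) (ℓ : ℕ) (ε : ℝ) : ℝ :=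
  ε * gammaRatio A ℓ / (1 - gammaRatio A ℓ)

/-- Some run of the while loop, from some matrix with orthonormal columns, ends with the
value `s` of `sNew`. -/
def LoopReturns {n D : ℕ} (A : Matrix (Fin n) (Fin D) ℝ) (i : Fin n) (ℓ : ℕ) (c s : ℝ) : Prop :=
  ∃ (X : Matrix (Fin D) (Fin ℓ) ℝ) (st : LoopState D ℓ), Xᵀ * X = 1 ∧
    Relation.ReflTransGen (LoopStep A i c) ⟨X, none, none⟩ st ∧ ¬ st.Continues c ∧
    st.sNew = some s

/-- Every run of the while loop, from any matrix with orthonormal columns and with any choice of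
eigenvectors, stops after finitely many iterations, and no iteration fails. -/
def LoopTerminates {n D : ℕ} (A : Matrix (Fin n) (Fin D) ℝ) (i : Fin n) (ℓ : ℕ) (c : ℝ) : Prop :=
  ∀ X : Matrix (Fin D) (Fin ℓ) ℝ, Xᵀ * X = 1 →
    Acc (fun st' st => LoopStep A i c st st') ⟨X, none, none⟩ ∧
    ∀ st : LoopState D ℓ, Relation.ReflTransGen (LoopStep A i c) ⟨X, none, none⟩ st →
      st.Continues c → ∃ st', LoopStep A i c st st'

/-- `s'` is a possible output of Non-Affine-Sensitivity for the weighted points `(p, w)` in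
`ℝ^D`, the `i`-th point, and the parameters `k` and `ε`. -/
def NonAffineOutput {n D : ℕ} (p : Fin n → EuclideanSpace ℝ (Fin D)) (w : Fin n → ℝ)
    (i : Fin n) (k : ℕ) (ε s' : ℝ) : Prop :=
  (k + 1 = D ∧ ∃ U σ V, IsThinSVD (weightedMatrix p w) U σ V ∧ s' = ∑ b, U i b ^ 2) ∨
  (k + 1 ≠ D ∧ ∃ s, LoopReturns (weightedMatrix p w) i (D - k)
    (threshold (weightedMatrix p w) (D - k) ε) s ∧ s' = s + ε)

/-- Every run of Non-Affine-Sensitivity terminates without failure (if `k = D - 1`, there is no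
loop). -/
def NonAffineTerminates {n D : ℕ} (p : Fin n → EuclideanSpace ℝ (Fin D)) (w : Fin n → ℝ)
    (i : Fin n) (k : ℕ) (ε : ℝ) : Prop :=
  k + 1 ≠ D → LoopTerminates (weightedMatrix p w) i (D - k)
    (threshold (weightedMatrix p w) (D - k) ε)

/-! ### The algorithm Affine-Sensitivity -/

/-- The number `ψ = (ε/2)²`. -/
def psi (ε : ℝ) : ℝ := (ε / 2) ^ 2

/-- The height `r = 1 + max_q D(q, 0) / (ψ ε²)`. -/
def height {n d : ℕ} (p : Fin n → EuclideanSpace ℝ (Fin d)) (ε : ℝ) : ℝ :=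
  1 + ⨆ j, dist (p j) 0 ^ 2 / (psi ε * ε ^ 2)

/-- The lifted points `(q ∣ r)` in `ℝ^(d+1)`. -/
def lift {n d : ℕ} (p : Fin n → EuclideanSpace ℝ (Fin d)) (ε : ℝ) :
    Fin n → EuclideanSpace ℝ (Fin (d + 1)) :=
  fun j => WithLp.toLp 2 (Fin.snoc (α := fun _ => ℝ) (fun a => p j a) (height p ε))

/-- `t` is a possible output of Affine-Sensitivity. -/
def AffineOutput {n d : ℕ} (p : Fin n → EuclideanSpace ℝ (Fin d)) (w : Fin n → ℝ)
    (i : Fin n) (k : ℕ) (ε t : ℝ) : Prop :=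
  ∃ s', NonAffineOutput (lift p ε) w i (k + 1) ε s' ∧ t = s' + 80 * ε

/-- Every run of Affine-Sensitivity terminates without failure. -/
def AffineTerminates {n d : ℕ} (p : Fin n → EuclideanSpace ℝ (Fin d)) (w : Fin n → ℝ)
    (i : Fin n) (k : ℕ) (ε : ℝ) : Prop :=
  NonAffineTerminates (lift p ε) w i (k + 1) ε

end

end AffineSens

/-! Put `ℓ = d - k`. A `k`-flat is the solution set of `Uᵀ x = c` for some `U` with `ℓ` orthonormal
columns, and its squared distance from `q` is `|Uᵀ q - c|²`. A linear `(k+1)`-subspace of `ℝ^(d+1)`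
is the kernel of `Xᵀ` for some `X` with `ℓ` orthonormal columns, and its squared distance from `q`
is `projSq X q`. The height `r` is so large that `|q| ≤ (ε²/4) r` for all points. Hence every flat
has a linear partner (`exists_comparable_of_flat`) and every linear subspace an affine partner
(`exists_flat_comparable`) for which, after one common rescaling, the two squared distances agree up
to a relative error `ε`, uniformly in the points. The common factor cancels in the quotient defining
the sensitivity, so the quotients differ by at most `ε` (`Comparable.abs_ratio_sub_le`). Therefore
`s(p)` is within `ε` of the supremum of `rowRatio` over the `X` with orthonormal columns.

For this supremum the loop is Dinkelbach's method: top eigenvectors of `aᵀa - t AᵀA` maximise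
`(rowRatio X - t) * frobSq X` by Ky Fan's principle. All values of `frobSq` lie between the sums of
the `ℓ` smallest and the `ℓ` largest eigenvalues of `AᵀA`, whose quotient is `γ`. So an increase of
less than `εγ/(1-γ)` shows that the current quotient is within `ε` of every other one
(`rowRatio_le_add_of_step`). If `ℓ = 1`, the supremum is the leverage score `|u|²`, read off from
the singular value decomposition. The accumulated error is at most `2ε`, well inside the additive
`80ε`.

For termination, the lifted matrix satisfies `0 < γ < 1` if no flat has zero cost (`threshold_pos`).
Every continued iteration after the first then raises a quotient bounded by `1` by at least a fixed
positive amount. -/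

namespace AffineSens

/-! ### Ky Fan's extremal principle for the trace of `Xᵀ G X` -/

section Spectral

variable {D ℓ n : ℕ}

theorem exists_eigenbasis {G : Matrix (Fin D) (Fin D) ℝ} (hG : G.IsHermitian) :
    ∃ V : Matrix (Fin D) (Fin (Fintype.card (Fin D))) ℝ,
      Vᵀ * V = 1 ∧ V * Vᵀ = 1 ∧
        ∀ a, G *ᵥ (fun c => V c a) = hG.eigenvalues₀ a • (fun c => V c a) := by
  let e : Fin (Fintype.card (Fin D)) ≃ Fin D := Fintype.equivOfCardEq (Fintype.card_fin _)
  let Q : Matrix (Fin D) (Fin D) ℝ := hG.eigenvectorUnitary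
  have h1 : Qᵀ * Q = 1 := by
    have := Unitary.coe_star_mul_self hG.eigenvectorUnitary
    simpa [Matrix.star_eq_conjTranspose] using this
  have h2 : Q * Qᵀ = 1 := by
    have := Unitary.coe_mul_star_self hG.eigenvectorUnitary
    simpa [Matrix.star_eq_conjTranspose] using this
  refine ⟨Q.submatrix id e, ?_, ?_, fun a => ?_⟩
  · rw [Matrix.transpose_submatrix, ← Matrix.submatrix_mul _ _ _ _ _ Function.bijective_id, h1]
    simp
  · rw [Matrix.transpose_submatrix, ← Matrix.submatrix_mul _ _ _ _ _ e.bijective, h2]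
    simp
  · have := hG.mulVec_eigenvectorBasis (e a)
    simpa [Matrix.IsHermitian.eigenvalues, e, Q] using this

theorem dotProduct_transpose_mulVec_le {m ℓ : Type*} [Fintype m] [Fintype ℓ] [DecidableEq ℓ]
    {X : Matrix m ℓ ℝ} (hX : Xᵀ * X = 1) (v : m → ℝ) :
    (Xᵀ *ᵥ v) ⬝ᵥ (Xᵀ *ᵥ v) ≤ v ⬝ᵥ v := by
  have h0 : 0 ≤ (v - X *ᵥ (Xᵀ *ᵥ v)) ⬝ᵥ (v - X *ᵥ (Xᵀ *ᵥ v)) :=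
    Finset.sum_nonneg fun _ _ => mul_self_nonneg _
  have h1 : v ⬝ᵥ (X *ᵥ (Xᵀ *ᵥ v)) = (Xᵀ *ᵥ v) ⬝ᵥ (Xᵀ *ᵥ v) := by
    rw [Matrix.dotProduct_mulVec, ← Matrix.mulVec_transpose]
  have h2 : (X *ᵥ (Xᵀ *ᵥ v)) ⬝ᵥ (X *ᵥ (Xᵀ *ᵥ v)) = (Xᵀ *ᵥ v) ⬝ᵥ (Xᵀ *ᵥ v) := by
    rw [Matrix.dotProduct_mulVec, ← Matrix.mulVec_transpose, Matrix.mulVec_mulVec, hX,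
      Matrix.one_mulVec]
  rw [sub_dotProduct, dotProduct_sub, dotProduct_sub, h2, dotProduct_comm (X *ᵥ (Xᵀ *ᵥ v)) v, h1]
    at h0
  linarith

theorem sum_sq_row_le_one {m ℓ : Type*} [Fintype m] [DecidableEq m] [Fintype ℓ] [DecidableEq ℓ]
    {X : Matrix m ℓ ℝ} (hX : Xᵀ * X = 1) (a : m) : ∑ b, X a b ^ 2 ≤ 1 := by
  have := dotProduct_transpose_mulVec_le hX (Pi.single a 1)
  rw [single_one_dotProduct, Pi.single_eq_same] at this
  simpa [dotProduct, sq] using this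

theorem sum_sq_eq_of_orthonormal {m : Type*} [Fintype m]
    {X : Matrix m (Fin ℓ) ℝ} (hX : Xᵀ * X = 1) : ∑ a, ∑ b, X a b ^ 2 = ℓ := by
  rw [Finset.sum_comm]
  have : ∀ b, ∑ a, X a b ^ 2 = 1 := fun b => by
    have := congrFun (congrFun hX b) b
    simpa [Matrix.mul_apply, sq] using this
  simp [this]

/-- The trace of `Xᵀ G X`. -/
def traceForm {m ℓ : Type*} [Fintype m] [Fintype ℓ] (G : Matrix m m ℝ) (X : Matrix m ℓ ℝ) : ℝ :=
  (Xᵀ * G * X).trace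

theorem traceForm_eq_sum {m ℓ : Type*} [Fintype m] [Fintype ℓ] (G : Matrix m m ℝ)
    (X : Matrix m ℓ ℝ) :
    traceForm G X = ∑ b, (fun c => X c b) ⬝ᵥ (G *ᵥ fun c => X c b) := by
  simp only [traceForm, Matrix.trace, Matrix.diag, Matrix.mul_assoc]
  rfl

/-- In an eigenbasis `V` of `G` the weight `h a` is the squared norm of row `a` of `Vᵀ X`. This
matrix has orthonormal columns, so its rows have norm at most `1` and its squared entries sum to
`ℓ`. -/
theorem exists_traceForm_eq {G : Matrix (Fin D) (Fin D) ℝ} (hG : G.IsHermitian)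
    {X : Matrix (Fin D) (Fin ℓ) ℝ} (hX : Xᵀ * X = 1) :
    ∃ h : Fin (Fintype.card (Fin D)) → ℝ, (∀ a, 0 ≤ h a) ∧ (∀ a, h a ≤ 1) ∧ ∑ a, h a = ℓ ∧
      traceForm G X = ∑ a, hG.eigenvalues₀ a * h a := by
  obtain ⟨V, hV, hV', hGV⟩ := exists_eigenbasis hG
  have hQ : (Vᵀ * X)ᵀ * (Vᵀ * X) = 1 := by
    rw [Matrix.transpose_mul, Matrix.transpose_transpose, Matrix.mul_assoc,
      ← Matrix.mul_assoc V, hV', Matrix.one_mul, hX]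
  refine ⟨fun a => ∑ b, (Vᵀ * X) a b ^ 2, fun a => Finset.sum_nonneg fun _ _ => sq_nonneg _,
    sum_sq_row_le_one hQ, sum_sq_eq_of_orthonormal hQ, ?_⟩
  have hG' : G * V = V * Matrix.diagonal hG.eigenvalues₀ := by
    ext c a
    have := congrFun (hGV a) c
    rw [Matrix.mul_diagonal]
    simpa [Matrix.mulVec, dotProduct, Matrix.mul_apply, mul_comm] using this
  have : Xᵀ * G * X = (Vᵀ * X)ᵀ * (Matrix.diagonal hG.eigenvalues₀ * (Vᵀ * X)) := by
    have : G = V * Matrix.diagonal hG.eigenvalues₀ * Vᵀ := by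
      rw [← hG', Matrix.mul_assoc, hV', Matrix.mul_one]
    conv_lhs => rw [this]
    simp [Matrix.mul_assoc]
  rw [traceForm, this, Matrix.trace]
  simp only [Matrix.diag, Matrix.mul_apply (M := (Vᵀ * X)ᵀ), Matrix.diagonal_mul,
    Matrix.transpose_apply (Vᵀ * X), Finset.mul_sum]
  rw [Finset.sum_comm]
  refine Finset.sum_congr rfl fun a _ => Finset.sum_congr rfl fun b _ => ?_
  ring

theorem card_filter_lt (hℓ : ℓ ≤ D) :
    (Finset.univ.filter fun a : Fin (Fintype.card (Fin D)) => a.val < ℓ).card = ℓ := by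
  rw [Fin.card_filter_val_lt]; simp [hℓ]

theorem card_filter_ge (hℓ : ℓ ≤ D) :
    (Finset.univ.filter fun a : Fin (Fintype.card (Fin D)) => D - ℓ ≤ a.val).card = ℓ := by
  have h := Finset.card_filter_add_card_filter_not (s := Finset.univ)
    (fun a : Fin (Fintype.card (Fin D)) => a.val < D - ℓ)
  rw [Fin.card_filter_val_lt] at h
  simp only [not_lt, Finset.card_univ, Fintype.card_fin] at h ⊢
  omega

/-- Weights in `[0, 1]` of total `ℓ` give the largest weighted sum when they are all placed on the
`ℓ` largest eigenvalues. -/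
theorem traceForm_le {G : Matrix (Fin D) (Fin D) ℝ} (hG : G.IsHermitian) (hℓ : ℓ ≤ D)
    (hℓ0 : 0 < ℓ) {X : Matrix (Fin D) (Fin ℓ) ℝ} (hX : Xᵀ * X = 1) :
    traceForm G X ≤
      ∑ a with (a : Fin (Fintype.card (Fin D))).val < ℓ, hG.eigenvalues₀ a := by
  obtain ⟨h, h0, h1, hs, ht⟩ := exists_traceForm_eq hG hX
  rw [ht, Finset.sum_filter]
  set μ := hG.eigenvalues₀ ⟨ℓ - 1, by simp; omega⟩
  have hc : ∑ a : Fin (Fintype.card (Fin D)), (if a.val < ℓ then (1 : ℝ) else 0) = ℓ := by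
    rw [Finset.sum_boole, card_filter_lt hℓ]
  -- The pivot `μ` is the `ℓ`-th largest eigenvalue, at index `ℓ - 1`, so both factors change sign
  -- at the same place. Subtracting `μ` costs nothing, since both weight systems have total `ℓ`.
  have key : 0 ≤ ∑ a, (hG.eigenvalues₀ a - μ) * ((if a.val < ℓ then (1 : ℝ) else 0) - h a) := by
    refine Finset.sum_nonneg fun a _ => ?_
    split_ifs with ha
    · have : μ ≤ hG.eigenvalues₀ a :=
        hG.eigenvalues₀_antitone (by rw [Fin.le_def]; show a.val ≤ ℓ - 1; omega)
      exact mul_nonneg (by linarith) (by linarith [h1 a])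
    · have : hG.eigenvalues₀ a ≤ μ :=
        hG.eigenvalues₀_antitone (by rw [Fin.le_def]; show ℓ - 1 ≤ a.val; omega)
      exact mul_nonneg_of_nonpos_of_nonpos (by linarith) (by linarith [h0 a])
  have e : ∑ a, (hG.eigenvalues₀ a - μ) * ((if a.val < ℓ then (1 : ℝ) else 0) - h a) =
      ∑ a, (if a.val < ℓ then hG.eigenvalues₀ a else 0) - ∑ a, hG.eigenvalues₀ a * h a
        - μ * (∑ a : Fin (Fintype.card (Fin D)), (if a.val < ℓ then (1 : ℝ) else 0) - ∑ a, h a) := by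
    rw [mul_sub, Finset.mul_sum, Finset.mul_sum, ← Finset.sum_sub_distrib,
      ← Finset.sum_sub_distrib, ← Finset.sum_sub_distrib]
    refine Finset.sum_congr rfl fun a _ => ?_
    split_ifs <;> ring
  rw [e, hc, hs] at key
  linarith

theorem le_traceForm {G : Matrix (Fin D) (Fin D) ℝ} (hG : G.IsHermitian) (hℓ : ℓ ≤ D)
    (hℓ0 : 0 < ℓ) {X : Matrix (Fin D) (Fin ℓ) ℝ} (hX : Xᵀ * X = 1) :
    ∑ a with D - ℓ ≤ (a : Fin (Fintype.card (Fin D))).val, hG.eigenvalues₀ a ≤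
      traceForm G X := by
  obtain ⟨h, h0, h1, hs, ht⟩ := exists_traceForm_eq hG hX
  rw [ht, Finset.sum_filter]
  set μ := hG.eigenvalues₀ ⟨D - ℓ, by simp; omega⟩
  have hc : ∑ a : Fin (Fintype.card (Fin D)), (if D - ℓ ≤ a.val then (1 : ℝ) else 0) = ℓ := by
    rw [Finset.sum_boole, card_filter_ge hℓ]
  have key : 0 ≤ ∑ a, (μ - hG.eigenvalues₀ a) *
      ((if D - ℓ ≤ a.val then (1 : ℝ) else 0) - h a) := by
    refine Finset.sum_nonneg fun a _ => ?_
    split_ifs with ha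
    · have : hG.eigenvalues₀ a ≤ μ :=
        hG.eigenvalues₀_antitone (by rw [Fin.le_def]; exact ha)
      exact mul_nonneg (by linarith) (by linarith [h1 a])
    · have : μ ≤ hG.eigenvalues₀ a :=
        hG.eigenvalues₀_antitone (by rw [Fin.le_def]; show a.val ≤ D - ℓ; omega)
      exact mul_nonneg_of_nonpos_of_nonpos (by linarith) (by linarith [h0 a])
  have e : ∑ a, (μ - hG.eigenvalues₀ a) * ((if D - ℓ ≤ a.val then (1 : ℝ) else 0) - h a) =
      ∑ a, hG.eigenvalues₀ a * h a - ∑ a, (if D - ℓ ≤ a.val then hG.eigenvalues₀ a else 0)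
        + μ * (∑ a : Fin (Fintype.card (Fin D)), (if D - ℓ ≤ a.val then (1 : ℝ) else 0)
          - ∑ a, h a) := by
    rw [mul_sub, Finset.mul_sum, Finset.mul_sum, ← Finset.sum_sub_distrib,
      ← Finset.sum_sub_distrib, ← Finset.sum_add_distrib]
    refine Finset.sum_congr rfl fun a _ => ?_
    split_ifs <;> ring
  rw [e, hc, hs] at key
  linarith

theorem exists_orthonormal_eigenvectors {G : Matrix (Fin D) (Fin D) ℝ} (hG : G.IsHermitian)
    {f : Fin ℓ → Fin (Fintype.card (Fin D))} (hf : Function.Injective f) :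
    ∃ X : Matrix (Fin D) (Fin ℓ) ℝ, Xᵀ * X = 1 ∧
      ∀ b, G *ᵥ (fun c => X c b) = hG.eigenvalues₀ (f b) • (fun c => X c b) := by
  obtain ⟨V, hV, -, hGV⟩ := exists_eigenbasis hG
  refine ⟨V.submatrix id f, ?_, fun b => hGV (f b)⟩
  rw [Matrix.transpose_submatrix, ← Matrix.submatrix_mul _ _ _ _ _ Function.bijective_id, hV]
  exact Matrix.submatrix_one _ hf

theorem traceForm_of_eigenvectors {G : Matrix (Fin D) (Fin D) ℝ}
    {X : Matrix (Fin D) (Fin ℓ) ℝ} (hX : Xᵀ * X = 1) {μ : Fin ℓ → ℝ}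
    (h : ∀ b, G *ᵥ (fun c => X c b) = μ b • (fun c => X c b)) :
    traceForm G X = ∑ b, μ b := by
  rw [traceForm_eq_sum]
  refine Finset.sum_congr rfl fun b _ => ?_
  have hb : (fun c => X c b) ⬝ᵥ (fun c => X c b) = 1 := by
    have := congrFun (congrFun hX b) b
    simpa [Matrix.mul_apply, dotProduct] using this
  rw [h b, dotProduct_smul, hb, smul_eq_mul, mul_one]

theorem exists_isTopEigenvectors {G : Matrix (Fin D) (Fin D) ℝ} (hG : G.IsHermitian)
    (hℓ : ℓ ≤ D) : ∃ X : Matrix (Fin D) (Fin ℓ) ℝ, IsTopEigenvectors hG X := by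
  have hℓ' : ℓ ≤ Fintype.card (Fin D) := by simpa using hℓ
  obtain ⟨X, hX, h⟩ := exists_orthonormal_eigenvectors hG (Fin.castLE_injective hℓ')
  refine ⟨X, hX, fun b a hab => ?_⟩
  have : a = Fin.castLE hℓ' b := Fin.ext hab
  rw [this, h b]

theorem traceForm_le_of_isTopEigenvectors {G : Matrix (Fin D) (Fin D) ℝ} {hG : G.IsHermitian}
    (hℓ : ℓ ≤ D) (hℓ0 : 0 < ℓ) {X Y : Matrix (Fin D) (Fin ℓ) ℝ} (hY : IsTopEigenvectors hG Y)
    (hX : Xᵀ * X = 1) : traceForm G X ≤ traceForm G Y := by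
  refine (traceForm_le hG hℓ hℓ0 hX).trans_eq ?_
  have hℓ' : ℓ ≤ Fintype.card (Fin D) := by simpa using hℓ
  rw [traceForm_of_eigenvectors hY.1 (μ := fun b => hG.eigenvalues₀ (Fin.castLE hℓ' b))
    (fun b => hY.2 b _ rfl)]
  symm
  refine Finset.sum_bij (fun b _ => Fin.castLE hℓ' b) (fun b _ => by simp)
    (fun _ _ _ _ h => Fin.castLE_injective hℓ' h) (fun a ha => ?_) (fun _ _ => rfl)
  exact ⟨⟨a.val, by simpa using ha⟩, Finset.mem_univ _, rfl⟩

/-- The lower Ky Fan bound is attained. This turns nonvanishing of every `frobSq A X` into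
positivity of the numerator of `γ`. -/
theorem exists_traceForm_eq_sum_bottom {G : Matrix (Fin D) (Fin D) ℝ} (hG : G.IsHermitian)
    (hℓ : ℓ ≤ D) : ∃ X : Matrix (Fin D) (Fin ℓ) ℝ, Xᵀ * X = 1 ∧ traceForm G X =
      ∑ a with D - ℓ ≤ (a : Fin (Fintype.card (Fin D))).val, hG.eigenvalues₀ a := by
  let f : Fin ℓ → Fin (Fintype.card (Fin D)) := fun b => ⟨D - ℓ + b.val, by simp; omega⟩
  have hf : Function.Injective f := fun a b h => by
    have := congrArg Fin.val h
    simp only [f] at this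
    exact Fin.ext (by omega)
  obtain ⟨X, hX, h⟩ := exists_orthonormal_eigenvectors hG hf
  refine ⟨X, hX, ?_⟩
  rw [traceForm_of_eigenvectors hX h]
  refine Finset.sum_bij (fun b _ => f b) (fun b _ => by simp [f]; omega)
    (fun _ _ _ _ h => hf h) (fun a ha => ?_) (fun _ _ => rfl)
  have ha' : D - ℓ ≤ a.val := by simpa using ha
  have := a.isLt
  simp only [Fintype.card_fin] at this
  exact ⟨⟨a.val - (D - ℓ), by omega⟩, Finset.mem_univ _, Fin.ext (by simp only [f]; omega)⟩

theorem frobSq_eq_traceForm (A : Matrix (Fin n) (Fin D) ℝ) (X : Matrix (Fin D) (Fin ℓ) ℝ) :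
    frobSq A X = traceForm (Aᵀ * A) X := by
  have : Xᵀ * (Aᵀ * A) * X = (A * X)ᵀ * (A * X) := by
    simp [Matrix.mul_assoc]
  rw [traceForm, this, frobSq, Matrix.trace, Finset.sum_comm]
  refine Finset.sum_congr rfl fun b _ => ?_
  rw [Matrix.diag, Matrix.mul_apply]
  exact Finset.sum_congr rfl fun j _ => by rw [Matrix.transpose_apply, sq]

theorem traceForm_pencil (A : Matrix (Fin n) (Fin D) ℝ) (i : Fin n) (s : ℝ)
    (X : Matrix (Fin D) (Fin ℓ) ℝ) :
    traceForm (pencil A i s) X = ∑ b, (A * X) i b ^ 2 - s * frobSq A X := by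
  rw [frobSq_eq_traceForm, traceForm, pencil, Matrix.mul_sub, Matrix.sub_mul, Matrix.trace_sub,
    Matrix.mul_smul, Matrix.smul_mul, Matrix.trace_smul, traceForm, smul_eq_mul]
  congr 1
  rw [Matrix.mul_vecMulVec, Matrix.vecMulVec_mul, Matrix.trace_vecMulVec, dotProduct]
  refine Finset.sum_congr rfl fun b _ => ?_
  have h1 : (Xᵀ *ᵥ A i) b = (A * X) i b := by
    simp [Matrix.mulVec, dotProduct, Matrix.mul_apply, mul_comm]
  have h2 : (A i ᵥ* X) b = (A * X) i b := rfl
  rw [h1, h2, sq]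

end Spectral

/-! ### Correctness and termination of the while loop -/

section Loop

variable {n D ℓ : ℕ} {A : Matrix (Fin n) (Fin D) ℝ} {i : Fin n}

theorem frobSq_nonneg (A : Matrix (Fin n) (Fin D) ℝ) (X : Matrix (Fin D) (Fin ℓ) ℝ) :
    0 ≤ frobSq A X :=
  Finset.sum_nonneg fun _ _ => Finset.sum_nonneg fun _ _ => sq_nonneg _

theorem sum_sq_row_le_frobSq (A : Matrix (Fin n) (Fin D) ℝ) (i : Fin n)
    (X : Matrix (Fin D) (Fin ℓ) ℝ) : ∑ b, (A * X) i b ^ 2 ≤ frobSq A X :=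
  Finset.single_le_sum (f := fun j => ∑ b, (A * X) j b ^ 2)
    (fun _ _ => Finset.sum_nonneg fun _ _ => sq_nonneg _) (Finset.mem_univ i)

theorem rowRatio_nonneg (A : Matrix (Fin n) (Fin D) ℝ) (i : Fin n)
    (X : Matrix (Fin D) (Fin ℓ) ℝ) : 0 ≤ rowRatio A i X :=
  div_nonneg (Finset.sum_nonneg fun _ _ => sq_nonneg _) (frobSq_nonneg _ _)

theorem rowRatio_le_one (A : Matrix (Fin n) (Fin D) ℝ) (i : Fin n)
    (X : Matrix (Fin D) (Fin ℓ) ℝ) : rowRatio A i X ≤ 1 :=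
  div_le_one_of_le₀ (sum_sq_row_le_frobSq _ _ _) (frobSq_nonneg _ _)

/-- The link between the fractional problem and the eigenvalue problem: maximising the trace form of
the pencil at `s` compares quotients with `s`, weighted by the denominator. -/
theorem traceForm_pencil_eq {X : Matrix (Fin D) (Fin ℓ) ℝ} (hX : frobSq A X ≠ 0) (s : ℝ) :
    traceForm (pencil A i s) X = (rowRatio A i X - s) * frobSq A X := by
  rw [traceForm_pencil, rowRatio, sub_mul, div_mul_cancel₀ _ hX]

/-- `X` has orthonormal columns, and the quotient `‖aX‖² / ‖A X‖_F²` is defined and equal to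
`s`. -/
def IsQuotient (A : Matrix (Fin n) (Fin D) ℝ) (i : Fin n) (X : Matrix (Fin D) (Fin ℓ) ℝ)
    (s : ℝ) : Prop :=
  Xᵀ * X = 1 ∧ frobSq A X ≠ 0 ∧ rowRatio A i X = s

/-- The invariant of the while loop: the quotients in the state come from consecutive matrices, each
of which was computed from the quotient of the one before. -/
def LoopInvariant (A : Matrix (Fin n) (Fin D) ℝ) (i : Fin n) (st : LoopState D ℓ) : Prop :=
  st.Xᵀ * st.X = 1 ∧ ∀ s, st.sNew = some s →
    IsTopEigenvectors (isHermitian_pencil A i s) st.X ∧ ∃ Y : Matrix (Fin D) (Fin ℓ) ℝ,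
      IsQuotient A i Y s ∧ ∀ t, st.sOld = some t →
        IsTopEigenvectors (isHermitian_pencil A i t) Y ∧ ∃ Z : Matrix (Fin D) (Fin ℓ) ℝ,
          IsQuotient A i Z t

theorem loopInvariant_of_reflTransGen {c : ℝ} {X : Matrix (Fin D) (Fin ℓ) ℝ} (hX : Xᵀ * X = 1)
    {st : LoopState D ℓ} (h : Relation.ReflTransGen (LoopStep A i c) ⟨X, none, none⟩ st) :
    LoopInvariant A i st := by
  induction h with
  | refl => exact ⟨hX, fun s hs => by cases hs⟩
  | @tail st _ _ hstep ih =>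
    cases hstep with
    | step X' hcont hdiv hX' =>
      refine ⟨hX'.1, fun s hs => ?_⟩
      obtain rfl : rowRatio A i st.X = s := Option.some.inj hs
      refine ⟨hX', st.X, ⟨ih.1, hdiv, rfl⟩, fun t ht => ?_⟩
      obtain ⟨h1, Y, hY, -⟩ := ih.2 t ht
      exact ⟨h1, Y, hY⟩

theorem le_frobSq (hℓ : ℓ ≤ D) (hℓ0 : 0 < ℓ) {X : Matrix (Fin D) (Fin ℓ) ℝ} (hX : Xᵀ * X = 1) :
    ∑ a with D - ℓ ≤ (a : Fin (Fintype.card (Fin D))).val, (isHermitian_gram A).eigenvalues₀ a ≤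
      frobSq A X := by
  rw [frobSq_eq_traceForm]
  exact le_traceForm _ hℓ hℓ0 hX

theorem frobSq_le (hℓ : ℓ ≤ D) (hℓ0 : 0 < ℓ) {X : Matrix (Fin D) (Fin ℓ) ℝ} (hX : Xᵀ * X = 1) :
    frobSq A X ≤
      ∑ a with (a : Fin (Fintype.card (Fin D))).val < ℓ, (isHermitian_gram A).eigenvalues₀ a := by
  rw [frobSq_eq_traceForm]
  exact traceForm_le _ hℓ hℓ0 hX

/-- With `m` and `M` the extreme eigenvalue sums, optimality of `Y` gives `(rowRatio X - t) m ≤ (s -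
t) M`, that is `(rowRatio X - t) γ ≤ s - t`. Subtracting `(s - t) γ` leaves `(rowRatio X - s) γ ≤ (s
- t)(1 - γ) < εγ`. -/
theorem rowRatio_le_add_of_step {ε s t : ℝ} (hℓ : ℓ ≤ D) (hℓ0 : 0 < ℓ) (hε : 0 < ε)
    {Y Z : Matrix (Fin D) (Fin ℓ) ℝ} (hY : IsQuotient A i Y s) (hZ : IsQuotient A i Z t)
    (hYt : IsTopEigenvectors (isHermitian_pencil A i t) Y) (hst : s - threshold A ℓ ε < t)
    {X : Matrix (Fin D) (Fin ℓ) ℝ} (hX : Xᵀ * X = 1) : rowRatio A i X ≤ s + ε := by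
  have hopt : ∀ X : Matrix (Fin D) (Fin ℓ) ℝ, Xᵀ * X = 1 → frobSq A X ≠ 0 →
      (rowRatio A i X - t) * frobSq A X ≤ (s - t) * frobSq A Y := fun X hX hX0 => by
    have := traceForm_le_of_isTopEigenvectors hℓ hℓ0 hYt hX
    rwa [traceForm_pencil_eq hX0, traceForm_pencil_eq hY.2.1, hY.2.2] at this
  have hYpos : 0 < frobSq A Y := (frobSq_nonneg _ _).lt_of_ne' hY.2.1
  -- The previous matrix `Z` is itself a competitor, with trace form `0`, so the quotients never
  -- decrease.
  have hts : t ≤ s := by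
    have := hopt Z hZ.1 hZ.2.1
    rw [hZ.2.2, sub_self, zero_mul] at this
    linarith [nonneg_of_mul_nonneg_left this hYpos]
  have hc : 0 < threshold A ℓ ε := by linarith
  have hle := le_frobSq (A := A) hℓ hℓ0 hX
  have hYle := frobSq_le (A := A) hℓ hℓ0 hY.1
  set m := ∑ a with D - ℓ ≤ (a : Fin (Fintype.card (Fin D))).val,
    (isHermitian_gram A).eigenvalues₀ a
  set M := ∑ a with (a : Fin (Fintype.card (Fin D))).val < ℓ, (isHermitian_gram A).eigenvalues₀ a
  have hγ : gammaRatio A ℓ = m / M := rfl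
  have hM : 0 < M := hYpos.trans_le hYle
  set γ := gammaRatio A ℓ
  have hm : m = γ * M := by rw [hγ, div_mul_cancel₀ _ hM.ne']
  -- Stopping with `t ≤ s` forces a positive threshold, and this alone excludes all degenerate
  -- values of `γ`, including `γ = 1`, where division by zero would make the threshold `0`.
  have hγ01 : 0 < γ ∧ γ < 1 := by
    rw [threshold, div_pos_iff] at hc
    rcases hc with ⟨h1, h2⟩ | ⟨h1, h2⟩
    · exact ⟨pos_of_mul_pos_right h1 hε.le, by linarith⟩
    · have := neg_of_mul_neg_right h1 hε.le
      linarith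
  obtain ⟨hγ0, hγ1⟩ := hγ01
  have hXpos : 0 < frobSq A X := (by rw [hm]; positivity : 0 < m).trans_le hle
  have hst' : (s - t) * (1 - γ) < ε * γ := by
    rw [← lt_div_iff₀ (by linarith)]
    change s - t < threshold A ℓ ε
    linarith
  have hX0 := hopt X hX hXpos.ne'
  rcases le_or_gt (rowRatio A i X) t with h | h
  · linarith
  have h1 : (rowRatio A i X - t) * (γ * M) ≤ (s - t) * M := by
    rw [← hm]
    calc _ ≤ _ := mul_le_mul_of_nonneg_left hle (by linarith)
      _ ≤ _ := hX0
      _ ≤ _ := mul_le_mul_of_nonneg_left hYle (by linarith)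
  have h2 : (rowRatio A i X - t) * γ ≤ s - t := by
    rw [← mul_assoc] at h1
    exact le_of_mul_le_mul_right h1 hM
  have h3 : (rowRatio A i X - s) * γ ≤ ε * γ := by linarith
  linarith [le_of_mul_le_mul_right h3 hγ0]

theorem loopReturns_spec {ε s : ℝ} (hℓ : ℓ ≤ D) (hℓ0 : 0 < ℓ) (hε : 0 < ε)
    (h : LoopReturns A i ℓ (threshold A ℓ ε) s) :
    (∃ Y : Matrix (Fin D) (Fin ℓ) ℝ, IsQuotient A i Y s) ∧
      ∀ X : Matrix (Fin D) (Fin ℓ) ℝ, Xᵀ * X = 1 → rowRatio A i X ≤ s + ε := by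
  obtain ⟨X₀, st, hX₀, hreach, hexit, hs⟩ := h
  obtain ⟨-, hinv⟩ := loopInvariant_of_reflTransGen hX₀ hreach
  obtain ⟨-, Y, hY, hYt⟩ := hinv s hs
  simp only [LoopState.Continues, not_forall, not_le] at hexit
  obtain ⟨s', t, hs', ht, hlt⟩ := hexit
  obtain rfl : s = s' := Option.some.inj (hs ▸ hs')
  obtain ⟨htop, Z, hZ⟩ := hYt t ht
  exact ⟨⟨Y, hY⟩, fun X hX => rowRatio_le_add_of_step hℓ hℓ0 hε hY hZ htop hlt hX⟩

theorem acc_loopStep_of_not_continues {c : ℝ} {st : LoopState D ℓ} (h : ¬ st.Continues c) :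
    Acc (fun st' st => LoopStep A i c st st') st :=
  ⟨_, fun _ hs => by cases hs with | step _ hcont _ _ => exact absurd hcont h⟩

/-- `N` bounds the remaining iterations: each continued one adds at least `c` to the quotient, which
cannot exceed `1`. -/
theorem acc_loopStep {c : ℝ} (hc : 0 < c) (N : ℕ) (st : LoopState D ℓ) (s : ℝ)
    (hs : st.sNew = some s) (hN : 1 < s + N * c) :
    Acc (fun st' st => LoopStep A i c st st') st := by
  induction N generalizing st s with
  | zero =>
    refine ⟨_, fun st' hst => acc_loopStep_of_not_continues fun hcont => ?_⟩
    cases hst with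
    | step X' _ _ _ =>
      have := hcont _ s rfl hs
      have := rowRatio_le_one A i st.X
      simp at hN
      linarith
  | succ N ih =>
    refine ⟨_, fun st' hst => ?_⟩
    by_cases hcont : st'.Continues c
    · cases hst with
      | step X' _ _ _ =>
        have := hcont _ s rfl hs
        refine ih _ _ rfl ?_
        push_cast at hN
        linarith
    · exact acc_loopStep_of_not_continues hcont

theorem loopTerminates_of_pos {c : ℝ} (hℓ : ℓ ≤ D) (hc : 0 < c)
    (hA : ∀ X : Matrix (Fin D) (Fin ℓ) ℝ, Xᵀ * X = 1 → frobSq A X ≠ 0) :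
    LoopTerminates A i ℓ c := by
  refine fun X hX => ⟨⟨_, fun st' hst => ?_⟩, fun st hst hcont => ?_⟩
  · cases hst with
    | step X' _ _ _ =>
      obtain ⟨N, hN⟩ := exists_nat_gt (1 / c)
      refine acc_loopStep hc N _ _ rfl ?_
      have := rowRatio_nonneg A i X
      rw [div_lt_iff₀ hc] at hN
      simp only
      linarith
  · obtain ⟨X', hX'⟩ := exists_isTopEigenvectors (ℓ := ℓ)
      (isHermitian_pencil A i (rowRatio A i st.X)) hℓ
    exact ⟨_, .step st X' hcont (hA _ (loopInvariant_of_reflTransGen hX hst).1) hX'⟩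

theorem exists_orthonormal_columns (hℓ : ℓ ≤ D) :
    ∃ X : Matrix (Fin D) (Fin ℓ) ℝ, Xᵀ * X = 1 := by
  refine ⟨(1 : Matrix (Fin D) (Fin D) ℝ).submatrix id (Fin.castLE hℓ), ?_⟩
  rw [Matrix.transpose_submatrix, ← Matrix.submatrix_mul _ _ _ _ _ Function.bijective_id]
  simp [Matrix.submatrix_one _ (Fin.castLE_injective hℓ)]

theorem exists_loopReturns {c : ℝ} (hℓ : ℓ ≤ D) (h : LoopTerminates A i ℓ c) :
    ∃ s, LoopReturns A i ℓ c s := by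
  obtain ⟨X, hX⟩ := exists_orthonormal_columns hℓ
  obtain ⟨hacc, hprog⟩ := h X hX
  have key : ∀ st, Acc (fun st' st => LoopStep A i c st st') st →
      Relation.ReflTransGen (LoopStep A i c) ⟨X, none, none⟩ st →
      ∃ s, LoopReturns A i ℓ c s := by
    intro st hst
    induction hst with
    | intro st _ ih =>
      intro hreach
      by_cases hcont : st.Continues c
      · obtain ⟨st', hst'⟩ := hprog st hreach hcont
        exact ih st' hst' (hreach.tail hst')
      · have hcont' := hcont
        simp only [LoopState.Continues, not_forall] at hcont'
        obtain ⟨s, -, hs, -⟩ := hcont'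
        exact ⟨s, X, st, hX, hreach, hcont, hs⟩
  exact key _ hacc .refl

/-- Two different values of `frobSq` separate the sums of the smallest and largest eigenvalues, so
`γ < 1`; attainment of the smallest sum gives `0 < γ`. -/
theorem threshold_pos {ε : ℝ} (hε : 0 < ε) (hℓ : ℓ ≤ D) (hℓ0 : 0 < ℓ)
    (hA : ∀ X : Matrix (Fin D) (Fin ℓ) ℝ, Xᵀ * X = 1 → frobSq A X ≠ 0)
    {X Y : Matrix (Fin D) (Fin ℓ) ℝ} (hX : Xᵀ * X = 1) (hY : Yᵀ * Y = 1)
    (hXY : frobSq A X < frobSq A Y) : 0 < threshold A ℓ ε := by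
  have hle := le_frobSq (A := A) hℓ hℓ0 hX
  have hYle := frobSq_le (A := A) hℓ hℓ0 hY
  obtain ⟨Z, hZ, hZm⟩ := exists_traceForm_eq_sum_bottom (isHermitian_gram A) hℓ
  rw [← frobSq_eq_traceForm] at hZm
  have hm : 0 < frobSq A Z := (frobSq_nonneg _ _).lt_of_ne' (hA Z hZ)
  rw [hZm] at hm
  set m := ∑ a with D - ℓ ≤ (a : Fin (Fintype.card (Fin D))).val,
    (isHermitian_gram A).eigenvalues₀ a
  set M := ∑ a with (a : Fin (Fintype.card (Fin D))).val < ℓ, (isHermitian_gram A).eigenvalues₀ a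
  have hγ : gammaRatio A ℓ = m / M := rfl
  have hM : m < M := by linarith
  have h0 : 0 < m / M := div_pos hm (hm.trans hM)
  have h1 : m / M < 1 := (div_lt_one (hm.trans hM)).2 hM
  rw [threshold, hγ]
  exact div_pos (mul_pos hε h0) (by linarith)

end Loop

/-! ### Thin singular value decompositions and leverage scores -/

section ThinSVD

variable {n D ℓ : ℕ} {A : Matrix (Fin n) (Fin D) ℝ}

theorem gram_eigenvalues_nonneg (A : Matrix (Fin n) (Fin D) ℝ) (a : Fin D) :
    0 ≤ (isHermitian_gram A).eigenvalues a := by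
  have : (Aᵀ * A).PosSemidef := by
    simpa using Matrix.posSemidef_conjTranspose_mul_self A
  exact this.eigenvalues_nonneg a

theorem gram_mul_eigenvectorUnitary (A : Matrix (Fin n) (Fin D) ℝ) :
    Aᵀ * A * ((isHermitian_gram A).eigenvectorUnitary : Matrix (Fin D) (Fin D) ℝ) =
      ((isHermitian_gram A).eigenvectorUnitary : Matrix (Fin D) (Fin D) ℝ) *
        Matrix.diagonal (isHermitian_gram A).eigenvalues := by
  ext c a
  have := congrFun ((isHermitian_gram A).mulVec_eigenvectorBasis a) c
  rw [Matrix.mul_diagonal, mul_comm]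
  exact this

/-- The columns of `V` are the eigenvectors of `AᵀA` with nonzero eigenvalue, `σ` consists of the
square roots of these eigenvalues, and `U = A V Σ⁻¹`. -/
theorem exists_isThinSVD (A : Matrix (Fin n) (Fin D) ℝ) : ∃ U σ V, IsThinSVD A U σ V := by
  set hG := isHermitian_gram A
  set μ := hG.eigenvalues
  let Q : Matrix (Fin D) (Fin D) ℝ := hG.eigenvectorUnitary
  have hQ1 : Qᵀ * Q = 1 := by
    have := Unitary.coe_star_mul_self hG.eigenvectorUnitary
    simpa [Matrix.star_eq_conjTranspose] using this
  have hQ2 : Q * Qᵀ = 1 := by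
    have := Unitary.coe_mul_star_self hG.eigenvectorUnitary
    simpa [Matrix.star_eq_conjTranspose] using this
  have hGQ : Aᵀ * A * Q = Q * Matrix.diagonal μ := gram_mul_eigenvectorUnitary A
  have hcard : Fintype.card (Fin A.rank) = Fintype.card {a // μ a ≠ 0} := by
    rw [Fintype.card_fin, ← hG.rank_eq_card_non_zero_eigs, Matrix.rank_transpose_mul_self]
  let e : Fin A.rank ≃ {a // μ a ≠ 0} := Fintype.equivOfCardEq hcard
  let f : Fin A.rank → Fin D := fun b => (e b).1
  have hf : Function.Injective f := Subtype.val_injective.comp e.injective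
  let V : Matrix (Fin D) (Fin A.rank) ℝ := Q.submatrix id f
  have hpos : ∀ b, 0 < μ (f b) := fun b =>
    (gram_eigenvalues_nonneg A (f b)).lt_of_ne' (e b).2
  let σ : Fin A.rank → ℝ := fun b => √(μ (f b))
  have hσ : ∀ b, σ b ≠ 0 := fun b => (Real.sqrt_pos.2 (hpos b)).ne'
  have hV : Vᵀ * V = 1 := by
    rw [Matrix.transpose_submatrix, ← Matrix.submatrix_mul _ _ _ _ _ Function.bijective_id, hQ1,
      Matrix.submatrix_one _ hf]
  have hGV : Aᵀ * A * V = V * Matrix.diagonal (μ ∘ f) := by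
    ext c b
    have := congrFun (congrFun hGQ c) (f b)
    rw [Matrix.mul_diagonal] at this ⊢
    exact this
  -- Eigenvectors with eigenvalue `0` are killed by `A`, so they can be dropped from `A = A Q Qᵀ`.
  have hAQ : ∀ a, μ a = 0 → ∀ j, (A * Q) j a = 0 := by
    intro a ha j
    have h1 : ∑ j, (A * Q) j a * (A * Q) j a = 0 := by
      change ((A * Q)ᵀ * (A * Q)) a a = 0
      have : (A * Q)ᵀ * (A * Q) = Qᵀ * (Aᵀ * A * Q) := by simp [Matrix.mul_assoc]
      rw [this, hGQ, ← Matrix.mul_assoc, hQ1, Matrix.one_mul, Matrix.diagonal_apply_eq, ha]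
    rw [Finset.sum_eq_zero_iff_of_nonneg fun _ _ => mul_self_nonneg _] at h1
    exact mul_self_eq_zero.1 (h1 j (Finset.mem_univ j))
  refine ⟨A * V * Matrix.diagonal fun b => (σ b)⁻¹, σ, V, ?_, hV, ?_⟩
  · have : (A * V * Matrix.diagonal fun b => (σ b)⁻¹)ᵀ * (A * V * Matrix.diagonal fun b => (σ b)⁻¹)
        = (Matrix.diagonal fun b => (σ b)⁻¹) * (Vᵀ * (Aᵀ * A * V)) *
          Matrix.diagonal fun b => (σ b)⁻¹ := by
      simp [Matrix.mul_assoc]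
    rw [this, hGV, ← Matrix.mul_assoc Vᵀ, hV, Matrix.one_mul, Matrix.diagonal_mul_diagonal,
      Matrix.diagonal_mul_diagonal, ← Matrix.diagonal_one]
    congr 1
    ext b
    have h2 : μ (f b) = σ b * σ b := (Real.mul_self_sqrt (hpos b).le).symm
    have := hσ b
    simp only [Function.comp, h2]
    field_simp
  · have hdd : (Matrix.diagonal fun b => (σ b)⁻¹) * Matrix.diagonal σ = 1 := by
      rw [Matrix.diagonal_mul_diagonal, ← Matrix.diagonal_one]
      congr 1
      ext b
      exact inv_mul_cancel₀ (hσ b)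
    rw [Matrix.mul_assoc (A * V), hdd, Matrix.mul_one]
    have hA : A = A * Q * Qᵀ := by rw [Matrix.mul_assoc, hQ2, Matrix.mul_one]
    conv_lhs => rw [hA]
    ext j c
    rw [Matrix.mul_apply, Matrix.mul_apply]
    have h1 : ∑ b, (A * V) j b * Vᵀ b c = ∑ x : {a // μ a ≠ 0}, (A * Q) j x * Qᵀ x c :=
      e.sum_comp fun x => (A * Q) j x * Qᵀ x c
    rw [h1, ← Finset.sum_subtype (Finset.univ.filter fun a => μ a ≠ 0) (by simp)
      (fun a => (A * Q) j a * Qᵀ a c)]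
    symm
    refine Finset.sum_subset (Finset.filter_subset _ _) fun a _ ha => ?_
    rw [hAQ a (by simpa using ha), zero_mul]

/-- Write `A X = U W` with `W = Σ Vᵀ X`. Orthonormality of `U` gives `‖A X‖_F = ‖W‖_F`, and row `i`
of `U W` is bounded by Cauchy-Schwarz in each column. -/
theorem IsThinSVD.sum_sq_row_le {U σ V} (h : IsThinSVD A U σ V) (i : Fin n)
    (X : Matrix (Fin D) (Fin ℓ) ℝ) :
    ∑ b, (A * X) i b ^ 2 ≤ (∑ c, U i c ^ 2) * frobSq A X := by
  obtain ⟨hU, -, hA⟩ := h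
  set W : Matrix (Fin A.rank) (Fin ℓ) ℝ := Matrix.diagonal σ * Vᵀ * X
  have hAX : A * X = U * W := by
    conv_lhs => rw [hA]
    simp [W, Matrix.mul_assoc]
  have hfrob : frobSq A X = ∑ c, ∑ b, W c b ^ 2 := by
    have h1 : (U * W)ᵀ * (U * W) = Wᵀ * W := by
      rw [Matrix.transpose_mul, Matrix.mul_assoc, ← Matrix.mul_assoc Uᵀ, hU, Matrix.one_mul]
    have h2 : ∀ b, ∑ j, (U * W) j b ^ 2 = ∑ c, W c b ^ 2 := fun b => by
      have := congrFun (congrFun h1 b) b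
      simpa only [Matrix.mul_apply (M := (U * W)ᵀ), Matrix.mul_apply (M := Wᵀ),
        Matrix.transpose_apply, ← sq] using this
    rw [frobSq, hAX, Finset.sum_comm]
    simp_rw [h2]
    rw [Finset.sum_comm]
  rw [hfrob, hAX, Finset.sum_comm, Finset.mul_sum]
  refine Finset.sum_le_sum fun b _ => ?_
  rw [Matrix.mul_apply]
  exact Finset.sum_mul_sq_le_sq_mul_sq _ _ _

theorem IsThinSVD.rowRatio_le {U σ V} (h : IsThinSVD A U σ V) (i : Fin n)
    (X : Matrix (Fin D) (Fin ℓ) ℝ) : rowRatio A i X ≤ ∑ c, U i c ^ 2 :=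
  div_le_of_le_mul₀ (frobSq_nonneg _ _) (Finset.sum_nonneg fun _ _ => sq_nonneg _)
    (h.sum_sq_row_le i X)

/-- The inner dimension equals the rank, so a zero on the diagonal would make the rank too small. -/
theorem IsThinSVD.diagonal_ne_zero {U σ V} (h : IsThinSVD A U σ V) (b : Fin A.rank) :
    σ b ≠ 0 := by
  intro hb
  have h1 : A.rank ≤ (Matrix.diagonal σ).rank := by
    conv_lhs => rw [h.2.2]
    exact (Matrix.rank_mul_le_left _ _).trans (Matrix.rank_mul_le_right _ _)
  rw [Matrix.rank_diagonal] at h1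
  have h2 := Fintype.card_subtype_lt (p := fun b => σ b ≠ 0) (x := b) (by simpa using hb)
  rw [Fintype.card_fin] at h2
  omega

/-- Equality in Cauchy-Schwarz: for `x = V Σ⁻¹ u`, with `u` the `i`-th row of `U`, one has `A x = U
u`. Both its `i`-th entry and its squared norm are `|u|²`. It remains to normalise `x`. -/
theorem IsThinSVD.exists_isQuotient {U σ V} (h : IsThinSVD A U σ V) (i : Fin n)
    (hne : ∑ c, U i c ^ 2 ≠ 0) :
    ∃ X : Matrix (Fin D) (Fin 1) ℝ, IsQuotient A i X (∑ c, U i c ^ 2) := by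
  have hσ := h.diagonal_ne_zero
  obtain ⟨hU, hV, hA⟩ := h
  set N := ∑ c, U i c ^ 2
  let x : Fin D → ℝ := V *ᵥ fun b => (σ b)⁻¹ * U i b
  have hAx : A *ᵥ x = U *ᵥ U i := by
    have : (Matrix.diagonal σ *ᵥ fun b => (σ b)⁻¹ * U i b) = U i := by
      ext b
      rw [Matrix.mulVec_diagonal, mul_inv_cancel_left₀ (hσ b)]
    conv_lhs => rw [hA]
    rw [Matrix.mulVec_mulVec, Matrix.mul_assoc _ Vᵀ, hV, Matrix.mul_one, ← Matrix.mulVec_mulVec,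
      this]
  have hi : (A *ᵥ x) i = N := by
    rw [hAx, Matrix.mulVec, dotProduct]
    exact Finset.sum_congr rfl fun _ _ => (sq _).symm
  have hn : (A *ᵥ x) ⬝ᵥ (A *ᵥ x) = N := by
    rw [hAx, Matrix.dotProduct_mulVec, ← Matrix.mulVec_transpose, Matrix.mulVec_mulVec, hU,
      Matrix.one_mulVec, dotProduct]
    exact Finset.sum_congr rfl fun _ _ => (sq _).symm
  have hx : 0 < x ⬝ᵥ x := by
    refine (Finset.sum_nonneg fun _ _ => mul_self_nonneg _).lt_of_ne' fun h0 => hne ?_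
    rw [← hi, dotProduct_self_eq_zero.1 h0, Matrix.mulVec_zero, Pi.zero_apply]
  set t := (√(x ⬝ᵥ x))⁻¹
  have ht : t * t * (x ⬝ᵥ x) = 1 := by
    rw [← mul_inv, Real.mul_self_sqrt hx.le, inv_mul_cancel₀ hx.ne']
  have ht0 : t ≠ 0 := fun h0 => by simp [h0] at ht
  let X : Matrix (Fin D) (Fin 1) ℝ := fun c _ => t * x c
  have hAX : ∀ j b, (A * X) j b = t * (A *ᵥ x) j := fun j b => by
    rw [Matrix.mul_apply, Matrix.mulVec, dotProduct, Finset.mul_sum]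
    exact Finset.sum_congr rfl fun c _ => by simp only [X]; ring
  have hfrob : frobSq A X = t ^ 2 * N := by
    simp only [frobSq, hAX, mul_pow, ← hn, dotProduct, Finset.mul_sum, Finset.univ_unique,
      Finset.sum_singleton]
    exact Finset.sum_congr rfl fun c _ => by ring
  refine ⟨X, ?_, ?_, ?_⟩
  · ext a b
    rw [Subsingleton.elim a b, Matrix.one_apply_eq, ← ht, Matrix.mul_apply, dotProduct,
      Finset.mul_sum]
    exact Finset.sum_congr rfl fun c _ => by
      change t * x c * (t * x c) = _
      ring
  · rw [hfrob]
    positivity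
  · rw [rowRatio, hfrob]
    simp only [hAX, hi, Finset.univ_unique, Finset.sum_singleton]
    field_simp

end ThinSVD

/-! ### Affine flats as solution sets of orthonormal linear systems -/

section Flats

variable {d k ℓ : ℕ}

theorem dist_sq_eq_dotProduct (x y : EuclideanSpace ℝ (Fin d)) :
    dist x y ^ 2 = (x.ofLp - y.ofLp) ⬝ᵥ (x.ofLp - y.ofLp) := by
  rw [EuclideanSpace.dist_eq, Real.sq_sqrt (Finset.sum_nonneg fun _ _ => sq_nonneg _), dotProduct]
  refine Finset.sum_congr rfl fun a _ => ?_
  rw [Real.dist_eq, sq_abs, sq]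
  rfl

theorem sqDist_eq_of_mem_iff {U : Matrix (Fin d) (Fin ℓ) ℝ} (hU : Uᵀ * U = 1) {c : Fin ℓ → ℝ}
    {S : Set (EuclideanSpace ℝ (Fin d))} (hS : ∀ x, x ∈ S ↔ Uᵀ *ᵥ x.ofLp = c)
    (q : EuclideanSpace ℝ (Fin d)) :
    sqDist q S = (Uᵀ *ᵥ q.ofLp - c) ⬝ᵥ (Uᵀ *ᵥ q.ofLp - c) := by
  set h := Uᵀ *ᵥ q.ofLp - c
  -- The foot of the perpendicular from `q` to `S`.
  let y : EuclideanSpace ℝ (Fin d) := WithLp.toLp 2 (q.ofLp - U *ᵥ h)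
  have hy : y ∈ S := by
    rw [hS]
    simp only [y]
    rw [Matrix.mulVec_sub, Matrix.mulVec_mulVec, hU, Matrix.one_mulVec]
    simp [h]
  have hqy : dist q y ^ 2 = h ⬝ᵥ h := by
    rw [dist_sq_eq_dotProduct]
    simp only [y, sub_sub_cancel]
    rw [Matrix.dotProduct_mulVec, ← Matrix.mulVec_transpose, Matrix.mulVec_mulVec, hU,
      Matrix.one_mulVec]
  have : Metric.infDist q S = dist q y := by
    refine le_antisymm (Metric.infDist_le_dist_of_mem hy) ?_
    rw [Metric.le_infDist ⟨y, hy⟩]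
    intro x hx
    refine le_of_sq_le_sq ?_ dist_nonneg
    rw [hqy, dist_sq_eq_dotProduct]
    have := dotProduct_transpose_mulVec_le hU (q.ofLp - x.ofLp)
    rwa [Matrix.mulVec_sub, (hS x).1 hx] at this
  rw [sqDist, this, hqy]

/-- The affine subspace of the solutions of `Uᵀ x = c`. -/
noncomputable def flat (U : Matrix (Fin d) (Fin ℓ) ℝ) (c : Fin ℓ → ℝ) :
    AffineSubspace ℝ (EuclideanSpace ℝ (Fin d)) :=
  AffineSubspace.mk' (WithLp.toLp 2 (U *ᵥ c))
    (LinearMap.ker (Uᵀ.mulVecLin ∘ₗ (WithLp.linearEquiv 2 ℝ (Fin d → ℝ)).toLinearMap))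

theorem mem_flat_iff {U : Matrix (Fin d) (Fin ℓ) ℝ} (hU : Uᵀ * U = 1) {c : Fin ℓ → ℝ}
    (x : EuclideanSpace ℝ (Fin d)) : x ∈ flat U c ↔ Uᵀ *ᵥ x.ofLp = c := by
  have h : Uᵀ *ᵥ (U *ᵥ c) = c := by rw [Matrix.mulVec_mulVec, hU, Matrix.one_mulVec]
  rw [flat, AffineSubspace.mem_mk', LinearMap.mem_ker]
  simp only [LinearMap.comp_apply, Matrix.mulVecLin_apply, LinearEquiv.coe_coe,
    WithLp.linearEquiv_apply, vsub_eq_sub]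
  change Uᵀ *ᵥ (x.ofLp - U *ᵥ c) = 0 ↔ _
  rw [Matrix.mulVec_sub, h, sub_eq_zero]

theorem flat_mem_affineFlats (hkd : k + ℓ = d) {U : Matrix (Fin d) (Fin ℓ) ℝ} (hU : Uᵀ * U = 1)
    (c : Fin ℓ → ℝ) : flat U c ∈ affineFlats d k := by
  refine ⟨⟨_, AffineSubspace.self_mem_mk' _ _⟩, ?_⟩
  rw [flat, AffineSubspace.direction_mk']
  set f := Uᵀ.mulVecLin ∘ₗ (WithLp.linearEquiv 2 ℝ (Fin d → ℝ)).toLinearMap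
  have hf : Function.Surjective f := fun v => ⟨WithLp.toLp 2 (U *ᵥ v), by
    change Uᵀ *ᵥ (U *ᵥ v) = v
    rw [Matrix.mulVec_mulVec, hU, Matrix.one_mulVec]⟩
  have h := LinearMap.finrank_range_add_finrank_ker f
  rw [LinearMap.range_eq_top.2 hf, finrank_top, finrank_euclideanSpace_fin,
    Module.finrank_fin_fun] at h
  have h' : Module.finrank ℝ (LinearMap.ker f) = k := by omega
  exact h'

/-- The columns of `U` are an orthonormal basis of the orthogonal complement of the direction, and
`c` is the value of `Uᵀ` at any point of the flat. -/
theorem exists_mem_iff_of_mem_affineFlats (hkd : k + ℓ = d)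
    {S : AffineSubspace ℝ (EuclideanSpace ℝ (Fin d))} (hS : S ∈ affineFlats d k) :
    ∃ (U : Matrix (Fin d) (Fin ℓ) ℝ) (c : Fin ℓ → ℝ), Uᵀ * U = 1 ∧
      ∀ x, x ∈ S ↔ Uᵀ *ᵥ x.ofLp = c := by
  obtain ⟨⟨s, hs⟩, hfin⟩ := hS
  have hℓ : Module.finrank ℝ S.directionᗮ = ℓ := by
    have := Submodule.finrank_add_finrank_orthogonal S.direction
    rw [finrank_euclideanSpace_fin] at this
    omega
  let b : OrthonormalBasis (Fin ℓ) ℝ S.directionᗮ :=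
    (stdOrthonormalBasis ℝ S.directionᗮ).reindex (finCongr hℓ)
  let U : Matrix (Fin d) (Fin ℓ) ℝ := Matrix.of fun a j => (b j : EuclideanSpace ℝ (Fin d)) a
  have hmul : ∀ (v : EuclideanSpace ℝ (Fin d)) j, (Uᵀ *ᵥ v.ofLp) j =
      inner ℝ (b j : EuclideanSpace ℝ (Fin d)) v := fun v j => by
    rw [PiLp.inner_apply, Matrix.mulVec, dotProduct]
    exact Finset.sum_congr rfl fun a _ => by simp [U, mul_comm]
  refine ⟨U, Uᵀ *ᵥ s.ofLp, ?_, fun x => ?_⟩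
  · ext j l
    have h1 : (Uᵀ * U) j l = (Uᵀ *ᵥ (b l : EuclideanSpace ℝ (Fin d)).ofLp) j := rfl
    rw [h1, hmul, Matrix.one_apply]
    exact orthonormal_iff_ite.1 b.orthonormal j l
  · rw [← AffineSubspace.vsub_right_mem_direction_iff_mem hs, vsub_eq_sub,
      ← Submodule.orthogonal_orthogonal S.direction, Submodule.mem_orthogonal]
    constructor
    · intro h
      rw [← sub_eq_zero, ← Matrix.mulVec_sub]
      ext j
      exact (hmul (x - s) j).trans (h _ (b j).2)
    · intro h u hu
      have h0 : ∀ j, inner ℝ (b j : EuclideanSpace ℝ (Fin d)) (x - s) = 0 := fun j => by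
        rw [← hmul]
        change (Uᵀ *ᵥ (x.ofLp - s.ofLp)) j = 0
        rw [Matrix.mulVec_sub, h, sub_self, Pi.zero_apply]
      have hsum : ∑ j, b.repr ⟨u, hu⟩ j • (b j : EuclideanSpace ℝ (Fin d)) = u := by
        have := congrArg Subtype.val (b.sum_repr ⟨u, hu⟩)
        rwa [AddSubmonoidClass.coe_finsetSum] at this
      rw [← hsum, sum_inner]
      refine Finset.sum_eq_zero fun j _ => ?_
      rw [inner_smul_left, h0, mul_zero]

end Flats

/-! ### Flats at height `r` and their linear spans -/

section Lifting

variable {d ℓ : ℕ}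

/-- The matrix `Y` with the row `z` added below it. -/
def appendRow (Y : Matrix (Fin d) (Fin ℓ) ℝ) (z : Fin ℓ → ℝ) : Matrix (Fin (d + 1)) (Fin ℓ) ℝ :=
  Matrix.of (Fin.snoc (α := fun _ => Fin ℓ → ℝ) Y z)

theorem appendRow_castSucc (Y : Matrix (Fin d) (Fin ℓ) ℝ) (z : Fin ℓ → ℝ) (a : Fin d)
    (b : Fin ℓ) : appendRow Y z a.castSucc b = Y a b :=
  congrFun (Fin.snoc_castSucc (α := fun _ => Fin ℓ → ℝ) z Y a) b

theorem appendRow_last (Y : Matrix (Fin d) (Fin ℓ) ℝ) (z : Fin ℓ → ℝ) (b : Fin ℓ) :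
    appendRow Y z (Fin.last d) b = z b :=
  congrFun (Fin.snoc_last (α := fun _ => Fin ℓ → ℝ) z Y) b

theorem appendRow_self (X : Matrix (Fin (d + 1)) (Fin ℓ) ℝ) :
    appendRow (X.submatrix Fin.castSucc id) (X (Fin.last d)) = X := by
  ext a b
  induction a using Fin.lastCases with
  | last => rw [appendRow_last]
  | cast a => rw [appendRow_castSucc]; rfl

theorem appendRow_transpose_mul (Y : Matrix (Fin d) (Fin ℓ) ℝ) (z : Fin ℓ → ℝ) :
    (appendRow Y z)ᵀ * appendRow Y z = Yᵀ * Y + Matrix.vecMulVec z z := by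
  ext a b
  rw [Matrix.mul_apply, Fin.sum_univ_castSucc]
  simp [appendRow_castSucc, appendRow_last, Matrix.mul_apply, Matrix.vecMulVec_apply]

/-- The lifted point `(q ∣ r)` as a plain vector. -/
def snocVec (q : Fin d → ℝ) (r : ℝ) : Fin (d + 1) → ℝ := Fin.snoc (α := fun _ => ℝ) q r

theorem appendRow_transpose_mulVec (Y : Matrix (Fin d) (Fin ℓ) ℝ) (z : Fin ℓ → ℝ)
    (q : Fin d → ℝ) (r : ℝ) :
    (appendRow Y z)ᵀ *ᵥ snocVec q r = Yᵀ *ᵥ q + r • z := by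
  ext b
  rw [Matrix.mulVec, dotProduct, Fin.sum_univ_castSucc]
  simp [appendRow_castSucc, appendRow_last, snocVec, Matrix.mulVec, dotProduct, mul_comm r]

theorem snocVec_dotProduct_self (q : Fin d → ℝ) (r : ℝ) :
    snocVec q r ⬝ᵥ snocVec q r = q ⬝ᵥ q + r * r := by
  rw [dotProduct, Fin.sum_univ_castSucc]
  simp [snocVec, dotProduct]

/-- Matrices `1 + a zzᵀ` are closed under multiplication, so square roots and inverses of `1 - zzᵀ`
reduce to scalar identities. -/
theorem one_add_smul_vecMulVec_mul (z : Fin ℓ → ℝ) (a b : ℝ) :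
    (1 + a • Matrix.vecMulVec z z) * (1 + b • Matrix.vecMulVec z z) =
      1 + (a + b + a * b * (z ⬝ᵥ z)) • Matrix.vecMulVec z z := by
  rw [add_mul, mul_add, mul_add, Matrix.smul_mul, Matrix.smul_mul, Matrix.mul_smul, Matrix.mul_smul,
    Matrix.vecMulVec_mul_vecMulVec]
  simp only [one_mul, mul_one, Matrix.vecMulVec_smul]
  module

theorem one_add_smul_vecMulVec_transpose (z : Fin ℓ → ℝ) (a : ℝ) :
    (1 + a • Matrix.vecMulVec z z)ᵀ = 1 + a • Matrix.vecMulVec z z := by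
  simp [Matrix.transpose_vecMulVec]

theorem one_add_smul_vecMulVec_mulVec (z v : Fin ℓ → ℝ) (a : ℝ) :
    (1 + a • Matrix.vecMulVec z z) *ᵥ v = v + (a * (z ⬝ᵥ v)) • z := by
  rw [Matrix.add_mulVec, Matrix.one_mulVec, Matrix.smul_mulVec, Matrix.vecMulVec_mulVec]
  ext b
  simp
  ring

theorem dotProduct_sq_le (u v : Fin ℓ → ℝ) : (u ⬝ᵥ v) ^ 2 ≤ (u ⬝ᵥ u) * (v ⬝ᵥ v) := by
  have := Finset.sum_mul_sq_le_sq_mul_sq Finset.univ u v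
  simpa only [dotProduct, sq] using this

/-- The scalar core of the comparison, with `y = |u|²`, `x = z ⬝ u`, `H = |h|²`, `g = z ⬝ h` for `u
= Uᵀ q` and `h = u + (r/τ) z`. The error `(H - g²) - τ² H` equals `Z y - x²` with `Z = 1 - τ²`: the
large terms in `r` cancel, and only the small `y` remains. -/
theorem lifted_bounds {τ r x y H g ε : ℝ} (hτ : 0 < τ) (hτ1 : τ ≤ 1) (hr : 0 < r) (hε : 0 < ε)
    (hε' : ε ≤ 1 / 12) (hy0 : 0 ≤ y) (hy : y ≤ (ε ^ 2 / 4 * r) ^ 2) (hx : x ^ 2 ≤ (1 - τ ^ 2) * y)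
    (hH : H = y + 2 * (r / τ) * x + (r / τ) ^ 2 * (1 - τ ^ 2))
    (hg : g = x + (r / τ) * (1 - τ ^ 2)) (hH0 : 0 ≤ H) :
    (1 - ε) * (H - g ^ 2) ≤ τ ^ 2 * H ∧ τ ^ 2 * H ≤ H - g ^ 2 := by
  set Z := 1 - τ ^ 2 with hZ
  have hZ0 : 0 ≤ Z := by nlinarith
  have hω : Z * H - g ^ 2 = Z * y - x ^ 2 := by rw [hH, hg]; ring
  have h2 : τ ^ 2 * H ≤ H - g ^ 2 := by
    have : τ ^ 2 * H = H - Z * H := by rw [hZ]; ring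
    linarith
  refine ⟨?_, h2⟩
  suffices h : Z * y - x ^ 2 ≤ ε * (H - g ^ 2) by
    have : τ ^ 2 * H = H - Z * H := by rw [hZ]; ring
    linarith
  have hβ : 4 * (ε ^ 2 / 4) ^ 2 ≤ ε / 2 := by
    have h3 : ε ^ 3 ≤ 1 := pow_le_one₀ hε.le (by linarith)
    have : 4 * (ε ^ 2 / 4) ^ 2 = ε * ε ^ 3 / 4 := by ring
    rw [this]
    nlinarith
  set β := ε ^ 2 / 4
  -- If `Z` is not tiny, the term `r² Z` dominates and `τ² H ≥ r² Z / 4`, which absorbs `Z y ≤ Z (β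
  -- r)²`. If `Z < 4β² ≤ ε/2`, then `Z ≤ ε τ²`, and already `Z H` is small compared with `τ² H`.
  rcases le_or_gt (4 * β ^ 2) Z with hc | hc
  · have e1 : τ ^ 2 * H = τ ^ 2 * y + 2 * r * τ * x + r ^ 2 * Z := by
      rw [hH]; field_simp
    have e2 : |2 * r * τ * x| ≤ r ^ 2 * Z / 2 + 2 * (τ ^ 2 * y) := by
      refine abs_le_of_sq_le_sq ?_ (by positivity)
      have h3 : (2 * r * τ * x) ^ 2 ≤ 4 * (r ^ 2 * Z) * (τ ^ 2 * y) := by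
        have := mul_le_mul_of_nonneg_left hx (by positivity : 0 ≤ 4 * r ^ 2 * τ ^ 2)
        linarith
      nlinarith [sq_nonneg (r ^ 2 * Z / 2 - 2 * (τ ^ 2 * y))]
    have e3 : τ ^ 2 * y ≤ y := mul_le_of_le_one_left hy0 (by nlinarith)
    have e4 : (β * r) ^ 2 ≤ r ^ 2 * Z / 4 := by nlinarith [sq_nonneg r]
    have e5 : r ^ 2 * Z / 4 ≤ τ ^ 2 * H := by
      rw [e1]
      linarith [(abs_le.1 e2).1]
    have e6 : Z * y ≤ Z * (β * r) ^ 2 := mul_le_mul_of_nonneg_left hy hZ0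
    have e7 : Z * (β * r) ^ 2 = 4 * β ^ 2 * (r ^ 2 * Z / 4) := by ring
    have e8 : 4 * β ^ 2 * (r ^ 2 * Z / 4) ≤ ε * (r ^ 2 * Z / 4) :=
      mul_le_mul_of_nonneg_right (by linarith) (by positivity)
    have e9 : ε * (r ^ 2 * Z / 4) ≤ ε * (H - g ^ 2) :=
      mul_le_mul_of_nonneg_left (by linarith) hε.le
    linarith [sq_nonneg x]
  · have e1 : Z ≤ ε * τ ^ 2 := by
      have : τ ^ 2 = 1 - Z := by rw [hZ]; ring
      rw [this]
      nlinarith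
    have e2 : Z * H ≤ ε * τ ^ 2 * H := mul_le_mul_of_nonneg_right e1 hH0
    have e3 : ε * (τ ^ 2 * H) ≤ ε * (H - g ^ 2) := mul_le_mul_of_nonneg_left h2 hε.le
    linarith [sq_nonneg g]

/-- The matrix whose column space is the orthogonal complement of the linear span of the lifted
flat `Uᵀ x = -(r / τ) z`, if `z ⬝ᵥ z = 1 - τ²`. -/
noncomputable def liftedNormals (U : Matrix (Fin d) (Fin ℓ) ℝ) (z : Fin ℓ → ℝ) (τ : ℝ) :
    Matrix (Fin (d + 1)) (Fin ℓ) ℝ :=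
  appendRow (U * (1 + (-(1 + τ)⁻¹) • Matrix.vecMulVec z z)) z

/-- Since `|z|² = 1 - τ²`, the matrix `1 - (1 + τ)⁻¹ zzᵀ` is the square root of `1 - zzᵀ`; the
appended row restores the missing `zzᵀ`. -/
theorem liftedNormals_transpose_mul {U : Matrix (Fin d) (Fin ℓ) ℝ} (hU : Uᵀ * U = 1)
    {z : Fin ℓ → ℝ} {τ : ℝ} (hτ : 0 < τ) (hz : z ⬝ᵥ z = 1 - τ ^ 2) :
    (liftedNormals U z τ)ᵀ * liftedNormals U z τ = 1 := by
  rw [liftedNormals, appendRow_transpose_mul, Matrix.transpose_mul, Matrix.mul_assoc,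
    ← Matrix.mul_assoc Uᵀ, hU, Matrix.one_mul, one_add_smul_vecMulVec_transpose,
    one_add_smul_vecMulVec_mul, hz]
  have : -(1 + τ)⁻¹ + -(1 + τ)⁻¹ + -(1 + τ)⁻¹ * -(1 + τ)⁻¹ * (1 - τ ^ 2) = -1 := by
    have : 1 + τ ≠ 0 := by positivity
    field_simp
    ring
  rw [this]
  module

/-- The square root of `1 - zzᵀ` maps `z` to `τ z`, so it maps `h` to `v`, and `|v|² = |h|² - (z ⬝
h)²`. The rest is `lifted_bounds`. -/
theorem liftedNormals_bounds {U : Matrix (Fin d) (Fin ℓ) ℝ} (hU : Uᵀ * U = 1)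
    {z : Fin ℓ → ℝ} {τ : ℝ} (hτ : 0 < τ) (hz : z ⬝ᵥ z = 1 - τ ^ 2) {r ε : ℝ} (hr : 0 < r)
    (hε : 0 < ε) (hε' : ε ≤ 1 / 12) {q : Fin d → ℝ} (hq : q ⬝ᵥ q ≤ (ε ^ 2 / 4 * r) ^ 2)
    {h v : Fin ℓ → ℝ} (hh : h = Uᵀ *ᵥ q + (r / τ) • z)
    (hv : v = (liftedNormals U z τ)ᵀ *ᵥ snocVec q r) :
    (1 - ε) * (v ⬝ᵥ v) ≤ τ ^ 2 * (h ⬝ᵥ h) ∧ τ ^ 2 * (h ⬝ᵥ h) ≤ v ⬝ᵥ v := by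
  have hz0 : 0 ≤ z ⬝ᵥ z := Finset.sum_nonneg fun _ _ => mul_self_nonneg _
  have hτ1 : τ ≤ 1 := by
    rw [hz] at hz0
    exact le_of_sq_le_sq (by linarith) zero_le_one
  set u := Uᵀ *ᵥ q
  have hvh : v = (1 + (-(1 + τ)⁻¹) • Matrix.vecMulVec z z) *ᵥ h := by
    rw [hv, liftedNormals, appendRow_transpose_mulVec, Matrix.transpose_mul,
      one_add_smul_vecMulVec_transpose, ← Matrix.mulVec_mulVec, hh, Matrix.mulVec_add,
      Matrix.mulVec_smul, one_add_smul_vecMulVec_mulVec z z, hz]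
    congr 1
    have : r = r / τ * (1 + -(1 + τ)⁻¹ * (1 - τ ^ 2)) := by
      have : 1 + τ ≠ 0 := by positivity
      field_simp
      ring
    conv_lhs => rw [this]
    module
  have hvv : v ⬝ᵥ v = h ⬝ᵥ h - (z ⬝ᵥ h) ^ 2 := by
    rw [hvh, one_add_smul_vecMulVec_mulVec]
    simp only [add_dotProduct, dotProduct_add, smul_dotProduct, dotProduct_smul, smul_eq_mul, hz,
      dotProduct_comm h z]
    have : 1 + τ ≠ 0 := by positivity
    field_simp
    ring
  rw [hvv]
  refine lifted_bounds (x := z ⬝ᵥ u) (y := u ⬝ᵥ u) hτ hτ1 hr hε hε'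
    (Finset.sum_nonneg fun _ _ => mul_self_nonneg _)
    ((dotProduct_transpose_mulVec_le hU q).trans hq) ?_ ?_ ?_
    (Finset.sum_nonneg fun _ _ => mul_self_nonneg _)
  · rw [← hz]
    exact dotProduct_sq_le z u
  · rw [hh]
    simp only [add_dotProduct, dotProduct_add, smul_dotProduct, dotProduct_smul, smul_eq_mul, hz,
      dotProduct_comm u z]
    ring
  · rw [hh]
    simp only [dotProduct_add, dotProduct_smul, smul_eq_mul, hz]

end Lifting

/-! ### Affine and linear partners with comparable squared distances -/

section Comparison

variable {n d k ℓ : ℕ}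

/-- The squared norm of the orthogonal projection of `v` to the column space of `X`, if the columns
of `X` are orthonormal. -/
def projSq {m : Type*} [Fintype m] (X : Matrix m (Fin ℓ) ℝ) (v : m → ℝ) : ℝ :=
  (Xᵀ *ᵥ v) ⬝ᵥ (Xᵀ *ᵥ v)

theorem projSq_nonneg {m : Type*} [Fintype m] (X : Matrix m (Fin ℓ) ℝ) (v : m → ℝ) :
    0 ≤ projSq X v := by
  rw [projSq]
  exact Finset.sum_nonneg fun _ _ => mul_self_nonneg _

/-- Up to a common factor, `a` and `b` differ by a relative error of at most `ε`. -/
def Comparable (ε : ℝ) (a b : Fin n → ℝ) : Prop :=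
  ∃ κ : ℝ, 0 < κ ∧ ∀ j, (1 - ε) * a j ≤ κ * b j ∧ κ * b j ≤ a j

theorem Comparable.sum_ne_zero_iff {ε : ℝ} (hε : ε < 1) {a b w : Fin n → ℝ}
    (h : Comparable ε a b) (hw : ∀ j, 0 ≤ w j) (ha : ∀ j, 0 ≤ a j) (hb : ∀ j, 0 ≤ b j) :
    ∑ j, w j * a j ≠ 0 ↔ ∑ j, w j * b j ≠ 0 := by
  obtain ⟨κ, hκ, h⟩ := h
  rw [not_iff_not, Finset.sum_eq_zero_iff_of_nonneg fun j _ => mul_nonneg (hw j) (ha j),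
    Finset.sum_eq_zero_iff_of_nonneg fun j _ => mul_nonneg (hw j) (hb j)]
  refine forall₂_congr fun j _ => ?_
  rw [mul_eq_zero, mul_eq_zero]
  refine or_congr_right ⟨fun h0 => ?_, fun h0 => ?_⟩
  · have := (h j).2
    rw [h0] at this
    exact le_antisymm (nonpos_of_mul_nonpos_right this hκ) (hb j)
  · have := (h j).1
    rw [h0, mul_zero] at this
    exact le_antisymm (nonpos_of_mul_nonpos_right this (by linarith)) (ha j)

theorem ratio_le_one {a w : Fin n → ℝ} (hw : ∀ j, 0 ≤ w j) (ha : ∀ j, 0 ≤ a j) (i : Fin n) :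
    w i * a i / ∑ j, w j * a j ≤ 1 :=
  div_le_one_of_le₀ (Finset.single_le_sum (f := fun j => w j * a j)
    (fun j _ => mul_nonneg (hw j) (ha j)) (Finset.mem_univ i))
    (Finset.sum_nonneg fun j _ => mul_nonneg (hw j) (ha j))

/-- The factor `κ` cancels, so each quotient is at least `1 - ε` times the other; as both are at
most `1`, the relative error becomes an absolute one. -/
theorem Comparable.abs_ratio_sub_le {ε : ℝ} (hε0 : 0 < ε) (hε : ε < 1) {a b w : Fin n → ℝ}
    (h : Comparable ε a b) (hw : ∀ j, 0 ≤ w j) (ha : ∀ j, 0 ≤ a j) (hb : ∀ j, 0 ≤ b j)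
    (hne : ∑ j, w j * a j ≠ 0) (i : Fin n) :
    |w i * a i / ∑ j, w j * a j - w i * b i / ∑ j, w j * b j| ≤ ε := by
  have hne' := (h.sum_ne_zero_iff hε hw ha hb).1 hne
  have ha1 := ratio_le_one hw ha i
  have hb1 := ratio_le_one hw hb i
  obtain ⟨κ, hκ, h⟩ := h
  have hA : 0 < ∑ j, w j * a j :=
    (Finset.sum_nonneg fun j _ => mul_nonneg (hw j) (ha j)).lt_of_ne' hne
  have hB : 0 < ∑ j, w j * b j :=
    (Finset.sum_nonneg fun j _ => mul_nonneg (hw j) (hb j)).lt_of_ne' hne'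
  have h1 : ∀ j, (1 - ε) * (w j * a j) ≤ κ * (w j * b j) := fun j => by
    have := mul_le_mul_of_nonneg_left (h j).1 (hw j)
    linarith
  have h2 : ∀ j, κ * (w j * b j) ≤ w j * a j := fun j => by
    have := mul_le_mul_of_nonneg_left (h j).2 (hw j)
    linarith
  have s1 : (1 - ε) * ∑ j, w j * a j ≤ κ * ∑ j, w j * b j := by
    rw [Finset.mul_sum, Finset.mul_sum]
    exact Finset.sum_le_sum fun j _ => h1 j
  have s2 : κ * ∑ j, w j * b j ≤ ∑ j, w j * a j := by
    rw [Finset.mul_sum]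
    exact Finset.sum_le_sum fun j _ => h2 j
  have hwa := mul_nonneg (hw i) (ha i)
  have hwb := mul_nonneg (hw i) (hb i)
  have hi1 := h1 i
  have hi2 := h2 i
  set A := ∑ j, w j * a j
  set B := ∑ j, w j * b j
  have r1 : (1 - ε) * (w i * a i / A) ≤ w i * b i / B := by
    rw [mul_div_assoc', div_le_div_iff₀ hA hB]
    refine le_of_mul_le_mul_left (a := κ) ?_ hκ
    calc κ * ((1 - ε) * (w i * a i) * B) = ((1 - ε) * (w i * a i)) * (κ * B) := by ring
      _ ≤ (κ * (w i * b i)) * A := mul_le_mul hi1 s2 (by positivity) (by positivity)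
      _ = κ * (w i * b i * A) := by ring
  have r2 : (1 - ε) * (w i * b i / B) ≤ w i * a i / A := by
    rw [mul_div_assoc', div_le_div_iff₀ hB hA]
    refine le_of_mul_le_mul_left (a := κ) ?_ hκ
    calc κ * ((1 - ε) * (w i * b i) * A) = (κ * (w i * b i)) * ((1 - ε) * A) := by ring
      _ ≤ (w i * a i) * (κ * B) := mul_le_mul hi2 s1 (mul_nonneg (by linarith) hA.le) hwa
      _ = κ * (w i * a i * B) := by ring
  rw [abs_le]
  constructor <;> nlinarith

variable {p : Fin n → EuclideanSpace ℝ (Fin d)} {r ε : ℝ}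

theorem exists_comparable_of_flat (hkd : k + ℓ = d) (hr : 0 < r) (hε : 0 < ε) (hε' : ε ≤ 1 / 12)
    (hp : ∀ j, (p j).ofLp ⬝ᵥ (p j).ofLp ≤ (ε ^ 2 / 4 * r) ^ 2)
    {S : AffineSubspace ℝ (EuclideanSpace ℝ (Fin d))} (hS : S ∈ affineFlats d k) :
    ∃ X : Matrix (Fin (d + 1)) (Fin ℓ) ℝ, Xᵀ * X = 1 ∧
      Comparable ε (fun j => projSq X (snocVec (p j).ofLp r))
        (fun j => sqDist (p j) (S : Set (EuclideanSpace ℝ (Fin d)))) := by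
  obtain ⟨U, c, hU, hSU⟩ := exists_mem_iff_of_mem_affineFlats hkd hS
  have hc : 0 ≤ c ⬝ᵥ c := Finset.sum_nonneg fun _ _ => mul_self_nonneg _
  have hpos : 0 < r ^ 2 + c ⬝ᵥ c := by positivity
  -- `τ` and `z` solve `(r/τ) z = -c` and `|z|² = 1 - τ²`.
  set τ := r / √(r ^ 2 + c ⬝ᵥ c)
  have hτ : 0 < τ := div_pos hr (Real.sqrt_pos.2 hpos)
  have hτ2 : τ ^ 2 = r ^ 2 / (r ^ 2 + c ⬝ᵥ c) := by
    rw [div_pow, Real.sq_sqrt hpos.le]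
  set z := (-(τ / r)) • c
  have hz : z ⬝ᵥ z = 1 - τ ^ 2 := by
    simp only [z, smul_dotProduct, dotProduct_smul, smul_eq_mul]
    have : -(τ / r) * (-(τ / r) * c ⬝ᵥ c) = τ ^ 2 * (c ⬝ᵥ c) / r ^ 2 := by
      field_simp
    rw [this, hτ2]
    field_simp
    ring
  refine ⟨liftedNormals U z τ, liftedNormals_transpose_mul hU hτ hz, τ ^ 2, by positivity,
    fun j => ?_⟩
  beta_reduce
  rw [sqDist_eq_of_mem_iff hU hSU]
  refine liftedNormals_bounds hU hτ hz hr hε hε' (hp j) ?_ rfl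
  have : (r / τ) • z = -c := by
    rw [smul_smul]
    have : r / τ * -(τ / r) = -1 := by field_simp
    rw [this, neg_one_smul]
  rw [this, sub_eq_add_neg]

/-- If `|z| < 1`, the linear subspace meets the hyperplane at height `r` in a `k`-flat, and
`liftedNormals` can be inverted to find its equations. -/
theorem exists_comparable_of_dotProduct_lt (hkd : k + ℓ = d) (hr : 0 < r) (hε : 0 < ε)
    (hε' : ε ≤ 1 / 12) (hp : ∀ j, (p j).ofLp ⬝ᵥ (p j).ofLp ≤ (ε ^ 2 / 4 * r) ^ 2)
    {Y : Matrix (Fin d) (Fin ℓ) ℝ} {z : Fin ℓ → ℝ}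
    (hX : (appendRow Y z)ᵀ * appendRow Y z = 1) (hz : z ⬝ᵥ z < 1) :
    ∃ S ∈ affineFlats d k, Comparable ε (fun j => projSq (appendRow Y z) (snocVec (p j).ofLp r))
      (fun j => sqDist (p j) (S : Set (EuclideanSpace ℝ (Fin d)))) := by
  set τ := √(1 - z ⬝ᵥ z)
  have hτ : 0 < τ := Real.sqrt_pos.2 (by linarith)
  have hz' : z ⬝ᵥ z = 1 - τ ^ 2 := by rw [Real.sq_sqrt (by linarith)]; ring
  have hY : Yᵀ * Y = 1 + (-1 : ℝ) • Matrix.vecMulVec z z := by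
    rw [appendRow_transpose_mul] at hX
    rw [← hX]
    module
  have h1τ : 1 + τ ≠ 0 := by positivity
  -- The second factor is the inverse square root of `1 - zzᵀ`, which equals `Yᵀ Y`.
  set U := Y * (1 + (τ * (1 + τ))⁻¹ • Matrix.vecMulVec z z) with hUdef
  have hU : Uᵀ * U = 1 := by
    rw [hUdef, Matrix.transpose_mul, one_add_smul_vecMulVec_transpose, Matrix.mul_assoc,
      ← Matrix.mul_assoc Yᵀ, hY, one_add_smul_vecMulVec_mul, one_add_smul_vecMulVec_mul, hz']
    have : ∀ t : ℝ, t = 0 → (1 : Matrix (Fin ℓ) (Fin ℓ) ℝ) + t • Matrix.vecMulVec z z = 1 :=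
      fun t ht => by rw [ht, zero_smul, add_zero]
    apply this
    field_simp
    ring
  have hYU : liftedNormals U z τ = appendRow Y z := by
    rw [liftedNormals, hUdef, Matrix.mul_assoc, one_add_smul_vecMulVec_mul, hz']
    have : (τ * (1 + τ))⁻¹ + -(1 + τ)⁻¹ + (τ * (1 + τ))⁻¹ * -(1 + τ)⁻¹ * (1 - τ ^ 2) = 0 := by
      field_simp
      ring
    rw [this, zero_smul, add_zero, Matrix.mul_one]
  refine ⟨flat U ((-(r / τ)) • z), flat_mem_affineFlats hkd hU _, τ ^ 2, by positivity,
    fun j => ?_⟩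
  beta_reduce
  rw [sqDist_eq_of_mem_iff hU (mem_flat_iff hU), neg_smul, sub_neg_eq_add, ← hYU]
  exact liftedNormals_bounds hU hτ hz' hr hε hε' (hp j) rfl rfl

/-- If `|z| = 1`, the linear subspace is horizontal and misses the hyperplane at height `r`, so it
comes from no flat. But then all squared distances of the lifted points are nearly `r²`, and any
flat at distance `r` from the origin serves as partner, its squared distances being nearly constant
too. -/
theorem exists_comparable_of_dotProduct_eq_one (hkd : k + ℓ = d) (hℓ0 : 0 < ℓ) (hr : 0 < r)
    (hε : 0 < ε) (hε' : ε ≤ 1 / 12)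
    (hp : ∀ j, (p j).ofLp ⬝ᵥ (p j).ofLp ≤ (ε ^ 2 / 4 * r) ^ 2)
    {Y : Matrix (Fin d) (Fin ℓ) ℝ} {z : Fin ℓ → ℝ}
    (hX : (appendRow Y z)ᵀ * appendRow Y z = 1) (hz : z ⬝ᵥ z = 1) :
    ∃ S ∈ affineFlats d k, Comparable ε (fun j => projSq (appendRow Y z) (snocVec (p j).ofLp r))
      (fun j => sqDist (p j) (S : Set (EuclideanSpace ℝ (Fin d)))) := by
  have hY : Yᵀ * Y = 1 + (-1 : ℝ) • Matrix.vecMulVec z z := by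
    rw [appendRow_transpose_mul] at hX
    rw [← hX]
    module
  have hYz : Y *ᵥ z = 0 := by
    rw [← dotProduct_self_eq_zero, Matrix.dotProduct_mulVec, ← Matrix.mulVec_transpose,
      Matrix.mulVec_mulVec, hY, one_add_smul_vecMulVec_mulVec, hz]
    simp
  obtain ⟨U, hU⟩ := exists_orthonormal_columns (D := d) (ℓ := ℓ) (by omega)
  set c : Fin ℓ → ℝ := Pi.single ⟨0, hℓ0⟩ r with hc
  set β := ε ^ 2 / 4 with hβ
  have hβ0 : 0 < β := by positivity
  -- Distances from the points to this flat are at most `(1 + β) r`, so this factor brings their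
  -- squares below `r²`.
  refine ⟨flat U c, flat_mem_affineFlats hkd hU _, ((1 + β) ^ 2)⁻¹, by positivity, fun j => ?_⟩
  have hE : projSq (appendRow Y z) (snocVec (p j).ofLp r) =
      (Yᵀ *ᵥ (p j).ofLp) ⬝ᵥ (Yᵀ *ᵥ (p j).ofLp) + r ^ 2 := by
    have h0 : (Yᵀ *ᵥ (p j).ofLp) ⬝ᵥ z = 0 := by
      rw [Matrix.mulVec_transpose, ← Matrix.dotProduct_mulVec, hYz, dotProduct_zero]
    rw [projSq, appendRow_transpose_mulVec]
    simp only [add_dotProduct, dotProduct_add, smul_dotProduct, dotProduct_smul, smul_eq_mul, hz,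
      dotProduct_comm z, h0]
    ring
  have hf : (Yᵀ *ᵥ (p j).ofLp) ⬝ᵥ (Yᵀ *ᵥ (p j).ofLp) ≤ (β * r) ^ 2 := by
    have := dotProduct_transpose_mulVec_le hX (snocVec (p j).ofLp 0)
    rw [appendRow_transpose_mulVec, snocVec_dotProduct_self, zero_smul, add_zero, mul_zero,
      add_zero] at this
    exact this.trans (hp j)
  have hf0 : 0 ≤ (Yᵀ *ᵥ (p j).ofLp) ⬝ᵥ (Yᵀ *ᵥ (p j).ofLp) :=
    Finset.sum_nonneg fun _ _ => mul_self_nonneg _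
  beta_reduce
  rw [sqDist_eq_of_mem_iff hU (mem_flat_iff hU)]
  have hu := (dotProduct_transpose_mulVec_le hU (p j).ofLp).trans (hp j)
  set u := Uᵀ *ᵥ (p j).ofLp
  have hD : (u - c) ⬝ᵥ (u - c) = u ⬝ᵥ u - 2 * r * u ⟨0, hℓ0⟩ + r ^ 2 := by
    rw [sub_dotProduct, dotProduct_sub, dotProduct_sub, dotProduct_comm c u, hc,
      dotProduct_single, dotProduct_single, Pi.single_eq_same]
    ring
  have hu0 : u ⟨0, hℓ0⟩ ^ 2 ≤ u ⬝ᵥ u := by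
    rw [sq]
    exact Finset.single_le_sum (f := fun b => u b * u b) (fun _ _ => mul_self_nonneg _)
      (Finset.mem_univ _)
  have hu1 : |u ⟨0, hℓ0⟩| ≤ β * r := abs_le_of_sq_le_sq (hu0.trans hu) (by positivity)
  obtain ⟨hl, hg⟩ := abs_le.1 hu1
  have huu : 0 ≤ u ⬝ᵥ u := Finset.sum_nonneg fun _ _ => mul_self_nonneg _
  have hD1 : (1 - 2 * β) * r ^ 2 ≤ (u - c) ⬝ᵥ (u - c) := by
    rw [hD]
    nlinarith
  have hD2 : (u - c) ⬝ᵥ (u - c) ≤ (1 + β) ^ 2 * r ^ 2 := by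
    rw [hD]
    nlinarith
  have hβε : 2 * β ≤ ε / 20 := by
    rw [hβ]
    nlinarith
  rw [hE, inv_mul_eq_div]
  constructor
  · rw [le_div_iff₀ (by positivity)]
    have h1 : (1 - ε) * (1 + β ^ 2) * (1 + β) ^ 2 ≤ 1 - 2 * β := by
      have hβ1 : β ≤ 1 / 100 := by linarith
      have e1 : (1 + β ^ 2) * (1 + β) ^ 2 ≤ 1 + 3 * β := by
        have b2 : β ^ 2 ≤ β / 100 := by nlinarith
        have b3 : β ^ 3 ≤ β / 100 := by nlinarith
        have b4 : β ^ 4 ≤ β / 100 := by nlinarith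
        linarith
      have e2 := mul_le_mul_of_nonneg_left e1 (by linarith : 0 ≤ 1 - ε)
      nlinarith
    calc (1 - ε) * ((Yᵀ *ᵥ (p j).ofLp) ⬝ᵥ (Yᵀ *ᵥ (p j).ofLp) + r ^ 2) * (1 + β) ^ 2
        ≤ (1 - ε) * ((β * r) ^ 2 + r ^ 2) * (1 + β) ^ 2 := by
          refine mul_le_mul_of_nonneg_right (mul_le_mul_of_nonneg_left ?_ ?_) (by positivity) <;>
          linarith
      _ = ((1 - ε) * (1 + β ^ 2) * (1 + β) ^ 2) * r ^ 2 := by ring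
      _ ≤ (1 - 2 * β) * r ^ 2 := mul_le_mul_of_nonneg_right h1 (by positivity)
      _ ≤ _ := hD1
  · rw [div_le_iff₀ (by positivity)]
    nlinarith [mul_nonneg hf0 (sq_nonneg (1 + β))]

theorem exists_flat_comparable (hkd : k + ℓ = d) (hℓ0 : 0 < ℓ) (hr : 0 < r)
    (hε : 0 < ε) (hε' : ε ≤ 1 / 12)
    (hp : ∀ j, (p j).ofLp ⬝ᵥ (p j).ofLp ≤ (ε ^ 2 / 4 * r) ^ 2)
    {X : Matrix (Fin (d + 1)) (Fin ℓ) ℝ} (hX : Xᵀ * X = 1) :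
    ∃ S ∈ affineFlats d k, Comparable ε (fun j => projSq X (snocVec (p j).ofLp r))
      (fun j => sqDist (p j) (S : Set (EuclideanSpace ℝ (Fin d)))) := by
  have hz : X (Fin.last d) ⬝ᵥ X (Fin.last d) ≤ 1 := by
    have := sum_sq_row_le_one hX (Fin.last d)
    simpa only [dotProduct, sq] using this
  rw [← appendRow_self X] at hX ⊢
  rcases hz.lt_or_eq with h | h
  · exact exists_comparable_of_dotProduct_lt hkd hr hε hε' hp hX h
  · exact exists_comparable_of_dotProduct_eq_one hkd hℓ0 hr hε hε' hp hX h

end Comparison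

/-! ### Transfer of the comparison to the sensitivity and to the loop -/

section Sensitivity

variable {n d k ℓ : ℕ} {p : Fin n → EuclideanSpace ℝ (Fin d)} {w : Fin n → ℝ} {ε : ℝ}

theorem sum_sq_weightedMatrix_mul {D : ℕ} (q : Fin n → EuclideanSpace ℝ (Fin D))
    (hw : ∀ j, 0 ≤ w j) (X : Matrix (Fin D) (Fin ℓ) ℝ) (j : Fin n) :
    ∑ b, (weightedMatrix q w * X) j b ^ 2 = w j * projSq X (q j).ofLp := by
  rw [projSq, dotProduct, Finset.mul_sum]
  refine Finset.sum_congr rfl fun b _ => ?_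
  have : (weightedMatrix q w * X) j b = √(w j) * (Xᵀ *ᵥ (q j).ofLp) b := by
    rw [Matrix.mul_apply, Matrix.mulVec, dotProduct, Finset.mul_sum]
    refine Finset.sum_congr rfl fun a _ => ?_
    simp only [weightedMatrix, Matrix.of_apply, Matrix.transpose_apply]
    ring
  rw [this, mul_pow, Real.sq_sqrt (hw j), sq]

theorem frobSq_weightedMatrix {D : ℕ} (q : Fin n → EuclideanSpace ℝ (Fin D))
    (hw : ∀ j, 0 ≤ w j) (X : Matrix (Fin D) (Fin ℓ) ℝ) :
    frobSq (weightedMatrix q w) X = ∑ j, w j * projSq X (q j).ofLp :=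
  Finset.sum_congr rfl fun j _ => sum_sq_weightedMatrix_mul q hw X j

theorem rowRatio_weightedMatrix {D : ℕ} (q : Fin n → EuclideanSpace ℝ (Fin D))
    (hw : ∀ j, 0 ≤ w j) (X : Matrix (Fin D) (Fin ℓ) ℝ) (i : Fin n) :
    rowRatio (weightedMatrix q w) i X =
      w i * projSq X (q i).ofLp / ∑ j, w j * projSq X (q j).ofLp := by
  rw [rowRatio, sum_sq_weightedMatrix_mul q hw, frobSq_weightedMatrix q hw]

theorem one_le_height (p : Fin n → EuclideanSpace ℝ (Fin d)) (ε : ℝ) : 1 ≤ height p ε := by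
  have : 0 ≤ ⨆ j, dist (p j) 0 ^ 2 / (psi ε * ε ^ 2) :=
    Real.iSup_nonneg fun j => by rw [psi]; positivity
  rw [height]
  linarith

theorem dotProduct_self_le_height (hε : 0 < ε) (j : Fin n) :
    (p j).ofLp ⬝ᵥ (p j).ofLp ≤ (ε ^ 2 / 4 * height p ε) ^ 2 := by
  have h1 : dist (p j) 0 ^ 2 = (p j).ofLp ⬝ᵥ (p j).ofLp := by
    rw [dist_sq_eq_dotProduct]
    simp
  have h2 : dist (p j) 0 ^ 2 / (psi ε * ε ^ 2) ≤ height p ε - 1 := by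
    rw [height, add_sub_cancel_left]
    exact le_ciSup (f := fun j => dist (p j) 0 ^ 2 / (psi ε * ε ^ 2)) (Set.finite_range _).bddAbove j
  have hψ : psi ε * ε ^ 2 = ε ^ 4 / 4 := by rw [psi]; ring
  rw [hψ, div_le_iff₀ (by positivity), h1] at h2
  -- This turns the bound on `|q|²`, linear in `r`, into the quadratic one used in the comparison.
  have h3 : height p ε - 1 ≤ height p ε ^ 2 / 4 := by nlinarith [sq_nonneg (height p ε - 2)]
  calc _ ≤ _ := h2
    _ ≤ height p ε ^ 2 / 4 * (ε ^ 4 / 4) := mul_le_mul_of_nonneg_right h3 (by positivity)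
    _ = _ := by ring

theorem ofLp_lift (p : Fin n → EuclideanSpace ℝ (Fin d)) (ε : ℝ) (j : Fin n) :
    (lift p ε j).ofLp = snocVec (p j).ofLp (height p ε) := rfl

theorem sqDist_nonneg (x : EuclideanSpace ℝ (Fin d)) (S : Set (EuclideanSpace ℝ (Fin d))) :
    0 ≤ sqDist x S := sq_nonneg _

theorem ratio_le_affineSensitivity (hw : ∀ j, 0 ≤ w j) (i : Fin n)
    {S : AffineSubspace ℝ (EuclideanSpace ℝ (Fin d))} (hS : S ∈ affineFlats d k)
    (hne : cost p w (S : Set (EuclideanSpace ℝ (Fin d))) ≠ 0) :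
    w i * sqDist (p i) S / cost p w (S : Set (EuclideanSpace ℝ (Fin d))) ≤
      affineSensitivity p w i k := by
  refine le_csSup ⟨1, ?_⟩ ⟨S, hS, hne, rfl⟩
  rintro x ⟨T, -, -, rfl⟩
  exact ratio_le_one hw (fun j => sqDist_nonneg (p j) T) i

theorem affineSensitivity_nonneg (hw : ∀ j, 0 ≤ w j) (i : Fin n) :
    0 ≤ affineSensitivity p w i k := by
  refine Real.sSup_nonneg ?_
  rintro x ⟨T, -, -, rfl⟩
  exact div_nonneg (mul_nonneg (hw i) (sqDist_nonneg _ _))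
    (Finset.sum_nonneg fun j _ => mul_nonneg (hw j) (sqDist_nonneg _ _))

theorem affineSensitivity_le (hkd : k + ℓ = d) (hw : ∀ j, 0 ≤ w j) (hε : 0 < ε)
    (hε' : ε ≤ 1 / 12) (i : Fin n) {s : ℝ} (hs : 0 ≤ s)
    (h : ∀ X : Matrix (Fin (d + 1)) (Fin ℓ) ℝ, Xᵀ * X = 1 →
      rowRatio (weightedMatrix (lift p ε) w) i X ≤ s) :
    affineSensitivity p w i k ≤ s + ε := by
  refine Real.sSup_le ?_ (by linarith)
  rintro x ⟨S, hS, hne, rfl⟩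
  obtain ⟨X, hX, hcomp⟩ := exists_comparable_of_flat hkd
    (zero_lt_one.trans_le (one_le_height p ε)) hε hε' (dotProduct_self_le_height hε) hS
  have hX1 := h X hX
  rw [rowRatio_weightedMatrix _ hw] at hX1
  have ha := fun j => projSq_nonneg X (snocVec (p j).ofLp (height p ε))
  have hb := fun j => sqDist_nonneg (p j) (S : Set (EuclideanSpace ℝ (Fin d)))
  have hne' := (hcomp.sum_ne_zero_iff (by linarith) hw ha hb).2 hne
  have := hcomp.abs_ratio_sub_le hε (by linarith) hw ha hb hne' i
  have := (abs_le.1 this).1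
  simp only [ofLp_lift] at hX1
  rw [cost]
  linarith

theorem le_affineSensitivity (hkd : k + ℓ = d) (hℓ0 : 0 < ℓ) (hw : ∀ j, 0 ≤ w j) (hε : 0 < ε)
    (hε' : ε ≤ 1 / 12) {i : Fin n} {s : ℝ} {X : Matrix (Fin (d + 1)) (Fin ℓ) ℝ}
    (h : IsQuotient (weightedMatrix (lift p ε) w) i X s) :
    s ≤ affineSensitivity p w i k + ε := by
  obtain ⟨hX, hne, rfl⟩ := h
  obtain ⟨S, hS, hcomp⟩ := exists_flat_comparable hkd hℓ0
    (zero_lt_one.trans_le (one_le_height p ε)) hε hε' (dotProduct_self_le_height (p := p) hε) hX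
  rw [frobSq_weightedMatrix _ hw] at hne
  rw [rowRatio_weightedMatrix _ hw]
  simp only [ofLp_lift] at hne ⊢
  have ha := fun j => projSq_nonneg X (snocVec (p j).ofLp (height p ε))
  have hb := fun j => sqDist_nonneg (p j) (S : Set (EuclideanSpace ℝ (Fin d)))
  have hne' := (hcomp.sum_ne_zero_iff (by linarith) hw ha hb).1 hne
  have := (abs_le.1 (hcomp.abs_ratio_sub_le hε (by linarith) hw ha hb hne i)).2
  have := ratio_le_affineSensitivity (p := p) hw i hS hne'
  rw [cost] at this
  linarith

theorem frobSq_lift_ne_zero (hkd : k + ℓ = d) (hℓ0 : 0 < ℓ) (hw : ∀ j, 0 ≤ w j) (hε : 0 < ε)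
    (hε' : ε ≤ 1 / 12)
    (hcost : ∀ S ∈ affineFlats d k, cost p w (S : Set (EuclideanSpace ℝ (Fin d))) ≠ 0)
    {X : Matrix (Fin (d + 1)) (Fin ℓ) ℝ} (hX : Xᵀ * X = 1) :
    frobSq (weightedMatrix (lift p ε) w) X ≠ 0 := by
  obtain ⟨S, hS, hcomp⟩ := exists_flat_comparable hkd hℓ0
    (zero_lt_one.trans_le (one_le_height p ε)) hε hε' (dotProduct_self_le_height (p := p) hε) hX
  rw [frobSq_weightedMatrix _ hw]
  exact (hcomp.sum_ne_zero_iff (by linarith) hw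
    (fun j => projSq_nonneg X (snocVec (p j).ofLp (height p ε)))
    (fun j => sqDist_nonneg (p j) (S : Set (EuclideanSpace ℝ (Fin d))))).2 (hcost S hS)

/-- Lifted points are almost vertical: normals orthogonal to the last axis see at most `(ε²/4 · r)²`
of each, normals containing that axis at least `r²`. This separates the extreme eigenvalue sums,
giving `γ < 1`. -/
theorem exists_frobSq_lift_lt (hℓ : ℓ ≤ d) (hℓ0 : 0 < ℓ) (hw : ∀ j, 0 ≤ w j)
    (hw0 : ∃ j, w j ≠ 0) (hε : 0 < ε) (hε' : ε ≤ 1 / 12) :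
    ∃ X Y : Matrix (Fin (d + 1)) (Fin ℓ) ℝ, Xᵀ * X = 1 ∧ Yᵀ * Y = 1 ∧
      frobSq (weightedMatrix (lift p ε) w) X < frobSq (weightedMatrix (lift p ε) w) Y := by
  obtain ⟨U, hU⟩ := exists_orthonormal_columns hℓ
  let f : Fin ℓ → Fin (d + 1) := fun b => Fin.rev (Fin.castLE (by omega) b)
  have hf : Function.Injective f := Fin.rev_injective.comp (Fin.castLE_injective _)
  have hf0 : f ⟨0, hℓ0⟩ = Fin.last d := by
    ext
    simp [f]
  set Y : Matrix (Fin (d + 1)) (Fin ℓ) ℝ :=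
    (1 : Matrix (Fin (d + 1)) (Fin (d + 1)) ℝ).submatrix id f with hY
  refine ⟨appendRow U 0, Y, ?_, ?_, ?_⟩
  · rw [appendRow_transpose_mul, hU]
    simp
  · rw [hY, Matrix.transpose_submatrix, ← Matrix.submatrix_mul _ _ _ _ _ Function.bijective_id,
      Matrix.transpose_one, Matrix.one_mul, Matrix.submatrix_one _ hf]
  rw [frobSq_weightedMatrix _ hw, frobSq_weightedMatrix _ hw]
  have hlt : ∀ j, projSq (appendRow U 0) (lift p ε j).ofLp < projSq Y (lift p ε j).ofLp := by
    intro j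
    have hr := one_le_height p ε
    have h1 : projSq (appendRow U 0) (lift p ε j).ofLp ≤ (ε ^ 2 / 4 * height p ε) ^ 2 := by
      rw [projSq, ofLp_lift, appendRow_transpose_mulVec, smul_zero, add_zero]
      exact (dotProduct_transpose_mulVec_le hU _).trans (dotProduct_self_le_height hε j)
    have h2 : height p ε ^ 2 ≤ projSq Y (lift p ε j).ofLp := by
      have h3 : (Yᵀ *ᵥ (lift p ε j).ofLp) ⟨0, hℓ0⟩ = height p ε := by
        have : (Yᵀ *ᵥ (lift p ε j).ofLp) ⟨0, hℓ0⟩ = (lift p ε j).ofLp (f ⟨0, hℓ0⟩) := by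
          simp [hY, Matrix.mulVec, dotProduct, Matrix.one_apply]
        rw [this, hf0, ofLp_lift, snocVec, Fin.snoc_last]
      rw [← h3, sq]
      exact Finset.single_le_sum (f := fun b => (Yᵀ *ᵥ (lift p ε j).ofLp) b *
        (Yᵀ *ᵥ (lift p ε j).ofLp) b) (fun _ _ => mul_self_nonneg _) (Finset.mem_univ _)
    have h4 : (ε ^ 2 / 4 * height p ε) ^ 2 < height p ε ^ 2 := by
      refine pow_lt_pow_left₀ (mul_lt_of_lt_one_left (by linarith) ?_) (by positivity) two_ne_zero
      nlinarith
    linarith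
  obtain ⟨j, hj⟩ := hw0
  exact Finset.sum_lt_sum (fun j _ => mul_le_mul_of_nonneg_left (hlt j).le (hw j))
    ⟨j, Finset.mem_univ j, mul_lt_mul_of_pos_left (hlt j) ((hw j).lt_of_ne' hj)⟩

theorem loopTerminates_lift (hkd : k + ℓ = d) (hℓ0 : 0 < ℓ) (hw : ∀ j, 0 ≤ w j) (i : Fin n)
    (hε : 0 < ε) (hε' : ε ≤ 1 / 12)
    (hcost : ∀ S ∈ affineFlats d k, cost p w (S : Set (EuclideanSpace ℝ (Fin d))) ≠ 0) :
    LoopTerminates (weightedMatrix (lift p ε) w) i ℓ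
      (threshold (weightedMatrix (lift p ε) w) ℓ ε) := by
  have hne := fun (X : Matrix (Fin (d + 1)) (Fin ℓ) ℝ) (hX : Xᵀ * X = 1) =>
    frobSq_lift_ne_zero hkd hℓ0 hw hε hε' hcost hX
  obtain ⟨U, hU⟩ := exists_orthonormal_columns (D := d) (ℓ := ℓ) (by omega)
  have hw0 : ∃ j, w j ≠ 0 := by
    by_contra! h0
    refine hcost _ (flat_mem_affineFlats hkd hU 0) ?_
    simp [cost, h0]
  obtain ⟨X, Y, hX, hY, hXY⟩ := exists_frobSq_lift_lt (p := p) (by omega) hℓ0 hw hw0 hε hε'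
  exact loopTerminates_of_pos (by omega) (threshold_pos hε (by omega) hℓ0 hne hX hY hXY) hne

end Sensitivity

end AffineSens

theorem mainTheorem1 (n d k : ℕ) (hk : k < d)
    (p : Fin n → EuclideanSpace ℝ (Fin d)) (w : Fin n → ℝ) (hw : ∀ j, 0 ≤ w j)
    (i : Fin n) (ε : ℝ) (hε : 0 < ε) (hε' : ε ≤ 1 / 12) :
    (∀ t : ℝ, AffineSens.AffineOutput p w i k ε t →
      AffineSens.affineSensitivity p w i k ≤ t ∧
        t ≤ AffineSens.affineSensitivity p w i k + 161 * ε) ∧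
    ((k + 1 = d ∨ ∀ S ∈ AffineSens.affineFlats d k,
        AffineSens.cost p w (S : Set (EuclideanSpace ℝ (Fin d))) ≠ 0) →
      (∃ t : ℝ, AffineSens.AffineOutput p w i k ε t) ∧
        AffineSens.AffineTerminates p w i k ε) := by
  have hkd : k + (d + 1 - (k + 1)) = d := by omega
  have hℓ0 : 0 < d + 1 - (k + 1) := by omega
  have hs0 := AffineSens.affineSensitivity_nonneg (p := p) (k := k) hw i
  constructor
  · rintro t ⟨s', ⟨hkd', U, σ, V, hsvd, rfl⟩ | ⟨-, s, hs, rfl⟩, rfl⟩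
    · have hN : 0 ≤ ∑ b, U i b ^ 2 := Finset.sum_nonneg fun _ _ => sq_nonneg _
      have hle := AffineSens.affineSensitivity_le (k := k) (ℓ := 1) (by omega) hw hε hε' i hN
        fun X _ => hsvd.rowRatio_le i X
      refine ⟨by linarith, ?_⟩
      -- For a zero row, `exists_isQuotient` supplies no witness, but nonnegativity of the
      -- sensitivity suffices.
      by_cases h0 : ∑ b, U i b ^ 2 = 0
      · rw [h0]
        linarith
      · obtain ⟨X, hX⟩ := hsvd.exists_isQuotient i h0
        have := AffineSens.le_affineSensitivity (k := k) (by omega) one_pos hw hε hε' hX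
        linarith
    · obtain ⟨⟨Y, hY⟩, hmax⟩ := AffineSens.loopReturns_spec (by omega) hℓ0 hε hs
      have hs : 0 ≤ s := hY.2.2 ▸ AffineSens.rowRatio_nonneg _ _ _
      have hle := AffineSens.affineSensitivity_le hkd hw hε hε' i (by linarith) hmax
      have := AffineSens.le_affineSensitivity hkd hℓ0 hw hε hε' hY
      constructor <;> linarith
  · intro h
    have hterm : AffineSens.AffineTerminates p w i k ε := fun hkd' =>
      AffineSens.loopTerminates_lift hkd hℓ0 hw i hε hε' (h.resolve_left (by omega))
    refine ⟨?_, hterm⟩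
    by_cases hkd' : k + 1 + 1 = d + 1
    · obtain ⟨U, σ, V, hsvd⟩ :=
        AffineSens.exists_isThinSVD (AffineSens.weightedMatrix (AffineSens.lift p ε) w)
      exact ⟨_, _, .inl ⟨hkd', U, σ, V, hsvd, rfl⟩, rfl⟩
    · obtain ⟨s, hs⟩ := AffineSens.exists_loopReturns (by omega) (hterm hkd')
      exact ⟨_, _, .inr ⟨hkd', s, hs, rfl⟩, rfl⟩
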